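/- Let $d\ge 0$, let $T$ be a Hermitian operator on $\mathcal H=\mathbb C^{d+1}$ and let $V$ be a Hermitian operator on $\mathcal H\otimes\mathcal H$ that is symmetric, i.e. commutes with the flip $x\otimes y\mapsto y\otimes x$ (this holds in particular if $V(x\otimes y)=V(y\otimes x)$ for all $x,y\in\mathcal H$). Let $\beta\in\mathbb R$. For $n\ge 2$ put \[ H_n=\sum_{i=1}^n T_i+\frac1{n-1}\sum_{1\le i<j\le n}V_{ij} \] on $\mathcal H^{\otimes n}$, where $T_i$ is $T$ applied to the $i$-th factor and $V_{ij}$ is $V$ applied to the $i$-th and $j$-th factors. Let $\Sigma_n$ be the orthogonal projector of $\mathcal H^{\otimes n}$ onto the subspace of vectors invariant under permutation of the factors, and let \[ \Gamma_n(\beta)=\frac{e^{-\beta H_n}\Sigma_n}{\mathrm{Tr}(e^{-\beta H_n}\Sigma_n)} . \] For an operator $D$ on $\mathcal H^{\otimes n}$ and $m\le n$ let $D_{:m}$ be its partial trace over the last $n-m$ factors. Let $\lambda_d$ be normalized Lebesgue measure on the simplex $\Delta_d=\{p\in\mathbb R^{d+1}: p_j\ge 0,\ \sum_{j=0}^d p_j=1\}$,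 let $\sigma(d\theta)=\prod_{j=0}^d d\theta_j/2\pi$ on $[0,2\pi)^{d+1}$, and let $P_{\mathrm v}$ be the projector onto the span of the unit vector $\mathrm v=\mathrm v(p,\theta)=\sum_{j=0}^d e^{i\theta_j}\sqrt{p_j}\,e_j$, where $\{e_j\}$ is the standard basis of $\mathbb C^{d+1}$. Then \[ Z_\beta=\int_{\Delta_d}\int_{[0,2\pi)^{d+1}} e^{-\beta\{\mathrm{Tr}(TP_{\mathrm v})+\mathrm{Tr}(V(P_{\mathrm v}\otimes P_{\mathrm v}))/2\}}\,\sigma(d\theta)\,\lambda_d(dp) \] is finite and positive, and for each $m\in\mathbb N$ the limit $G_m=\lim_{n\to\infty}\{\Gamma_n(\beta/n)\}_{:m}$ exists, is a density operator on $\mathcal H^{\otimes m}$ (positive semidefinite with trace $1$), and has the de Finetti representation \[ G_m=\frac1{Z_\beta}\int_{\Delta_d}\int_{[0,2\pi)^{d+1}} P_{\mathrm v}^{\otimes m}\, e^{-\beta\{\mathrm{Tr}(TP_{\mathrm v})+\mathrm{Tr}(V(P_{\mathrm v}\otimes P_{\mathrm v}))/2\}}\,\sigma(d\theta)\,\lambda_d(dp).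 \] -/

import Mathlib

open MeasureTheory Filter Topology
open scoped Kronecker ComplexOrder

noncomputable section

namespace MeanFieldBosons

/-- Labels of the product basis `e_{x 0} ⊗ ⋯ ⊗ e_{x (n-1)}` of `(ℂ^{d+1})^{⊗ n}`. -/
abbrev Cfg (d n : ℕ) : Type := Fin n → Fin (d + 1)

/-- Operators on `(ℂ^{d+1})^{⊗ n}`, as matrices in the product basis. -/
abbrev Op (d n : ℕ) : Type := Matrix (Cfg d n) (Cfg d n) ℂ

/-- The single-particle operator `T` applied to the `i`-th factor. -/
def oneBody {d : ℕ} (T : Matrix (Fin (d + 1)) (Fin (d + 1)) ℂ) {n : ℕ} (i : Fin n) : Op d n :=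
  Matrix.of fun x y => if ∀ k, k ≠ i → x k = y k then T (x i) (y i) else 0

/-- The two-particle operator `V` applied to the `i`-th and `j`-th factors (for `i ≠ j`). -/
def twoBody {d : ℕ} (V : Matrix (Fin (d + 1) × Fin (d + 1)) (Fin (d + 1) × Fin (d + 1)) ℂ)
    {n : ℕ} (i j : Fin n) : Op d n :=
  Matrix.of fun x y =>
    if ∀ k, k ≠ i → k ≠ j → x k = y k then V (x i, x j) (y i, y j) else 0

/-- The permutation operator `U_π (x₁ ⊗ ⋯ ⊗ xₙ) = x_{π 1} ⊗ ⋯ ⊗ x_{π n}`. -/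
def permOp (d : ℕ) {n : ℕ} (π : Equiv.Perm (Fin n)) : Op d n :=
  Matrix.of fun x y => if x = fun k => y (π k) then 1 else 0

/-- The projector onto the symmetric vectors, `Σ_n = (1/n!) ∑_π U_π`. -/
def symProj (d n : ℕ) : Op d n :=
  (n.factorial : ℂ)⁻¹ • ∑ π : Equiv.Perm (Fin n), permOp d π

/-- The mean-field Hamiltonian `H_n = ∑ᵢ Tᵢ + (1/(n-1)) ∑_{i<j} V_{ij}` (meant for `n ≥ 2`). -/
def hamiltonian {d : ℕ} (T : Matrix (Fin (d + 1)) (Fin (d + 1)) ℂ)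
    (V : Matrix (Fin (d + 1) × Fin (d + 1)) (Fin (d + 1) × Fin (d + 1)) ℂ) (n : ℕ) : Op d n :=
  ∑ i : Fin n, oneBody T i
    + ((n : ℂ) - 1)⁻¹ • ∑ i : Fin n, ∑ j ∈ Finset.univ.filter (fun j : Fin n => i < j),
        twoBody V i j

/-- `e^{-β H_n} Σ_n`. -/
def gibbsNumerator {d : ℕ} (T : Matrix (Fin (d + 1)) (Fin (d + 1)) ℂ)
    (V : Matrix (Fin (d + 1) × Fin (d + 1)) (Fin (d + 1) × Fin (d + 1)) ℂ) (n : ℕ) (β : ℝ) :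
    Op d n :=
  NormedSpace.exp (-(β : ℂ) • hamiltonian T V n) * symProj d n

/-- The bosonic Gibbs density `Γ_n(β) = e^{-β H_n} Σ_n / Tr (e^{-β H_n} Σ_n)`. -/
def gibbs {d : ℕ} (T : Matrix (Fin (d + 1)) (Fin (d + 1)) ℂ)
    (V : Matrix (Fin (d + 1) × Fin (d + 1)) (Fin (d + 1) × Fin (d + 1)) ℂ) (n : ℕ) (β : ℝ) :
    Op d n :=
  (gibbsNumerator T V n β).trace⁻¹ • gibbsNumerator T V n β

/-- The label whose first `m` entries are those of `x` and whose remaining entries are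
those of `z`. -/
def glue {d m n : ℕ} (x : Cfg d m) (z : {i : Fin n // m ≤ (i : ℕ)} → Fin (d + 1)) : Cfg d n :=
  fun i => if h : (i : ℕ) < m then x ⟨i, h⟩ else z ⟨i, not_lt.mp h⟩

/-- The `m`-particle reduction `D_{n:m}` (`m ≤ n`): the partial trace of `D` over all factors
but the first `m`. -/
def reduction {d n : ℕ} (m : ℕ) (D : Op d n) : Op d m :=
  Matrix.of fun x y =>
    ∑ z : {i : Fin n // m ≤ (i : ℕ)} → Fin (d + 1), D (glue x z) (glue y z)

/-- The solid simplex in `ℝ^d`, the image of `Δ_d` under dropping the coordinate `p_0`. -/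
def solidSimplex (d : ℕ) : Set (Fin d → ℝ) :=
  {q | (∀ i, 0 ≤ q i) ∧ ∑ i, q i ≤ 1}

/-- Normalized Lebesgue measure `λ_d` on the simplex
`Δ_d = {p ∈ ℝ^{d+1} | 0 ≤ p_i, ∑ p_i = 1}`: the uniform probability measure in the affine
coordinates `(p_1, …, p_d)`, transported by `q ↦ (1 - ∑ q_i, q_1, …, q_d)`. -/
def simplexMeasure (d : ℕ) : Measure (Fin (d + 1) → ℝ) :=
  (ProbabilityTheory.cond (volume : Measure (Fin d → ℝ)) (solidSimplex d)).map
    fun q => Fin.cons (1 - ∑ i, q i) q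

/-- The measure `σ(dθ) = ∏_j dθ_j / 2π` on `[0, 2π)^{d+1}`. -/
def phaseMeasure (d : ℕ) : Measure (Fin (d + 1) → ℝ) :=
  Measure.pi fun _ =>
    ProbabilityTheory.cond (volume : Measure ℝ) (Set.Ico 0 (2 * Real.pi))

/-- The vector `v(p, θ) = ∑_j e^{i θ_j} √p_j e_j`. -/
def vec {d : ℕ} (p θ : Fin (d + 1) → ℝ) : Fin (d + 1) → ℂ :=
  fun j => Complex.exp (Complex.I * (θ j : ℂ)) * (Real.sqrt (p j) : ℂ)

/-- The operator `P_v = |v⟩⟨v|`, the rank-one projector onto `v` when `v` is a unit vector. -/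
def proj {d : ℕ} (v : Fin (d + 1) → ℂ) : Matrix (Fin (d + 1)) (Fin (d + 1)) ℂ :=
  Matrix.vecMulVec v (star v)

/-- The `m`-fold tensor power `A ⊗ ⋯ ⊗ A`. -/
def tensorPow {d : ℕ} (A : Matrix (Fin (d + 1)) (Fin (d + 1)) ℂ) (m : ℕ) : Op d m :=
  Matrix.of fun x y => ∏ k, A (x k) (y k)

/-- The weight `exp (-β {Tr (T P_v) + Tr (V (P_v ⊗ P_v)) / 2})`. For Hermitian `T` and `V`
both traces are real. -/
def weight {d : ℕ} (T : Matrix (Fin (d + 1)) (Fin (d + 1)) ℂ)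
    (V : Matrix (Fin (d + 1) × Fin (d + 1)) (Fin (d + 1) × Fin (d + 1)) ℂ) (β : ℝ)
    (v : Fin (d + 1) → ℂ) : ℝ :=
  Real.exp (-β * ((T * proj v).trace.re + (V * (proj v ⊗ₖ proj v)).trace.re / 2))

/-- The normalization `Z_β`. -/
def partitionFn {d : ℕ} (T : Matrix (Fin (d + 1)) (Fin (d + 1)) ℂ)
    (V : Matrix (Fin (d + 1) × Fin (d + 1)) (Fin (d + 1) × Fin (d + 1)) ℂ) (β : ℝ) : ℝ :=
  ∫ p, ∫ θ, weight T V β (vec p θ) ∂(phaseMeasure d) ∂(simplexMeasure d)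

/-- The operator-valued integral
`∫∫ P_v^{⊗ m} exp (-β {Tr (T P_v) + Tr (V (P_v ⊗ P_v)) / 2}) σ(dθ) λ_d(dp)`, entry by entry. -/
def deFinettiIntegral {d : ℕ} (T : Matrix (Fin (d + 1)) (Fin (d + 1)) ℂ)
    (V : Matrix (Fin (d + 1) × Fin (d + 1)) (Fin (d + 1) × Fin (d + 1)) ℂ) (β : ℝ) (m : ℕ) :
    Op d m :=
  Matrix.of fun x y =>
    ∫ p, ∫ θ, tensorPow (proj (vec p θ)) m x y * (weight T V β (vec p θ) : ℂ)
      ∂(phaseMeasure d) ∂(simplexMeasure d)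

end MeanFieldBosons

end

/-!
The coherent product states `v ⊗ ⋯ ⊗ v`, with `v = v(p, θ)` distributed according to `λ_d ⊗ σ`,
resolve the symmetric projector: `Σ_n` is `dim(Sym_n)` times the average of their projectors
(`symProj_apply`). The phases kill the matrix elements between configurations with different
occupation numbers, and the remaining ones are the Dirichlet moments `d! ∏ k_j! / (n + d)!`
(`integral_prod_pow_simplexMeasure`), which match the number of permutations relating two
configurations with the same occupation numbers. Hence `e^{-β H_n / n} Σ_n` is `dim(Sym_n)` times
the average of the rank-one operators `e^{-β H_n / n} |v^{⊗n}⟩⟨v^{⊗n}|`.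

At temperature scale `β / n` the operator `H_n / n` is an average over pairs of two-body operators.
It is bounded uniformly in `n` (Schur's test, `norm_twoBody_le`), and in the state `v^{⊗n}`
fluctuations over disjoint pairs are orthogonal, so that a second-moment count gives
`‖(H_n / n - h(v)) v^{⊗n}‖ = O(n^{-1/2})` uniformly in `v`, where `h(v)` is the classical energy
(`norm_fluct_mulVec_le`). The exponential series turns this into
`e^{-β H_n / n} v^{⊗n} = e^{-β h(v)} v^{⊗n} + O(n^{-1/2})` (`norm_exp_hamiltonian_mulVec_sub_le`).
Partial traces of rank-one operators are controlled by the Cauchy–Schwarz inequality, and the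
partial trace of the projector onto `v^{⊗n}` is the one onto `v^{⊗m}`, so the rescaled reductions
converge to the de Finetti integral (`tendsto_reduction_gibbsNumerator`). The case `m = 0` gives
the convergence of the rescaled partition functions to `Z_β`, and the rescaling cancels in the
quotient.
-/

noncomputable section

namespace MeanFieldBosons

/-! ### Moments of the uniform measure on the simplex -/

/-- The density `t ↦ t^k / k!` on the half-line `t ≥ 0`, extended by zero. Iterated convolutions
of these densities are again of this form, which is what makes the simplex moments explicit. -/
def truncPow (k : ℕ) (t : ℝ) : ENNReal :=
  ENNReal.ofReal (if 0 ≤ t then t ^ k / k.factorial else 0)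

lemma measurable_truncPow (k : ℕ) : Measurable (truncPow k) := by
  unfold truncPow
  refine ENNReal.measurable_ofReal.comp (Measurable.ite measurableSet_Ici ?_ measurable_const)
  fun_prop

/-- The beta integral with natural exponents, by repeated integration by parts. -/
lemma integral_pow_mul_sub_pow (r : ℝ) (a b : ℕ) :
    ∫ t in (0 : ℝ)..r, t ^ a / a.factorial * ((r - t) ^ b / b.factorial)
      = r ^ (a + b + 1) / (a + b + 1).factorial := by
  have hv : ∀ (b : ℕ) (x : ℝ), HasDerivAt (fun t : ℝ => -((r - t) ^ (b + 1) / (b + 1).factorial))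
      ((r - x) ^ b / b.factorial) x := by
    intro b x
    have h := ((((hasDerivAt_id x).const_sub r).pow (b + 1)).div_const
      ((b + 1).factorial : ℝ)).neg
    refine HasDerivAt.congr_deriv h ?_
    rw [Nat.factorial_succ]
    have : (b.factorial : ℝ) ≠ 0 := by positivity
    have : ((b : ℝ) + 1) ≠ 0 := by positivity
    simp
    field_simp
  induction a generalizing b with
  | zero =>
    simp only [pow_zero, Nat.factorial_zero, Nat.cast_one, div_one, one_mul, zero_add]
    rw [intervalIntegral.integral_eq_sub_of_hasDerivAt (fun x _ => hv b x)]
    · simp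
    · exact Continuous.intervalIntegrable (by fun_prop) _ _
  | succ a ih =>
    have hu : ∀ x : ℝ, HasDerivAt (fun t : ℝ => t ^ (a + 1) / (a + 1).factorial)
        (x ^ a / a.factorial) x := by
      intro x
      have h := ((hasDerivAt_id x).pow (a + 1)).div_const ((a + 1).factorial : ℝ)
      refine HasDerivAt.congr_deriv h ?_
      rw [Nat.factorial_succ]
      have : (a.factorial : ℝ) ≠ 0 := by positivity
      have : ((a : ℝ) + 1) ≠ 0 := by positivity
      simp
      field_simp
    rw [intervalIntegral.integral_mul_deriv_eq_deriv_mul (fun x _ => hu x) (fun x _ => hv b x)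
      (Continuous.intervalIntegrable (by fun_prop) _ _)
      (Continuous.intervalIntegrable (by fun_prop) _ _)]
    simp only [mul_neg, intervalIntegral.integral_neg, ih (b + 1)]
    simp
    ring_nf

lemma lintegral_truncPow_mul_truncPow (a b : ℕ) (r : ℝ) :
    ∫⁻ t, truncPow a t * truncPow b (r - t) = truncPow (a + b + 1) r := by
  have h : ∀ t, truncPow a t * truncPow b (r - t) = (Set.Icc 0 r).indicator
      (fun t => ENNReal.ofReal (t ^ a / a.factorial * ((r - t) ^ b / b.factorial))) t := by
    intro t
    by_cases ht : 0 ≤ t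
    · by_cases hr : t ≤ r
      · rw [Set.indicator_of_mem (Set.mem_Icc.mpr ⟨ht, hr⟩), ENNReal.ofReal_mul (by positivity)]
        simp [truncPow, ht, hr]
      · rw [Set.indicator_of_notMem (fun hh => hr hh.2)]
        simp [truncPow, hr]
    · rw [Set.indicator_of_notMem (fun hh => ht hh.1)]
      simp [truncPow, ht]
  simp_rw [h]
  rw [lintegral_indicator measurableSet_Icc]
  by_cases hr : 0 ≤ r
  · rw [← ofReal_integral_eq_lintegral_ofReal]
    · rw [integral_Icc_eq_integral_Ioc, ← intervalIntegral.integral_of_le hr,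
        integral_pow_mul_sub_pow]
      simp [truncPow, hr]
    · exact Continuous.integrableOn_Icc (by fun_prop)
    · refine (ae_restrict_mem measurableSet_Icc).mono fun t ht => ?_
      have h1 : 0 ≤ t := ht.1
      have h2 : 0 ≤ r - t := sub_nonneg.mpr ht.2
      simp only [Pi.zero_apply]
      positivity
  · rw [Set.Icc_eq_empty hr]
    simp [truncPow, hr]

/-- Dirichlet's integral, as an iterated convolution. -/
lemma lintegral_prod_truncPow {d : ℕ} (k : Fin d → ℕ) (b : ℕ) (r : ℝ) :
    ∫⁻ q : Fin d → ℝ, (∏ i, truncPow (k i) (q i)) * truncPow b (r - ∑ i, q i)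
      = truncPow (∑ i, k i + b + d) r := by
  induction d generalizing r with
  | zero =>
    rw [Measure.volume_pi_eq_dirac]
    simp
  | succ d ih =>
    have hm : Measurable fun q : Fin (d + 1) → ℝ =>
        (∏ i, truncPow (k i) (q i)) * truncPow b (r - ∑ i, q i) := by
      refine Measurable.mul ?_ ((measurable_truncPow b).comp (by fun_prop))
      exact Finset.measurable_prod _ fun i _ =>
        (measurable_truncPow (k i)).comp (measurable_pi_apply i)
    have e := volume_preserving_piFinSuccAbove (fun _ : Fin (d + 1) => ℝ) 0
    rw [← e.symm.lintegral_comp hm, Measure.volume_eq_prod, lintegral_prod]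
    · have hin : ∀ t : ℝ, ∫⁻ q : Fin d → ℝ, (∏ i, truncPow (k i)
          ((MeasurableEquiv.piFinSuccAbove (fun _ : Fin (d + 1) => ℝ) 0).symm (t, q) i))
          * truncPow b (r - ∑ i, (MeasurableEquiv.piFinSuccAbove
            (fun _ : Fin (d + 1) => ℝ) 0).symm (t, q) i)
          = truncPow (k 0) t * truncPow (∑ i : Fin d, k i.succ + b + d) (r - t) := by
        intro t
        rw [← ih, ← lintegral_const_mul]
        · refine lintegral_congr fun q => ?_
          simp only [Fin.prod_univ_succ, Fin.sum_univ_succ, MeasurableEquiv.piFinSuccAbove_symm_apply]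
          simp [Fin.insertNthEquiv, mul_assoc, sub_sub]
        · refine Measurable.mul ?_ ((measurable_truncPow b).comp (by fun_prop))
          exact Finset.measurable_prod _ fun i _ =>
            (measurable_truncPow _).comp (measurable_pi_apply i)
      simp_rw [hin]
      rw [lintegral_truncPow_mul_truncPow, Fin.sum_univ_succ]
      congr 1
      ring
    · exact (hm.comp (MeasurableEquiv.measurable _)).aemeasurable

lemma isCompact_solidSimplex (d : ℕ) : IsCompact (solidSimplex d) := by
  refine (isCompact_Icc (a := (0 : Fin d → ℝ)) (b := 1)).of_isClosed_subset ?_ ?_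
  · have h1 : IsClosed {q : Fin d → ℝ | ∀ i, 0 ≤ q i} := isClosed_Ici (a := (0 : Fin d → ℝ))
    have h2 : IsClosed {q : Fin d → ℝ | ∑ i, q i ≤ 1} :=
      isClosed_le (by fun_prop) continuous_const
    exact h1.inter h2
  · intro q hq
    refine ⟨fun i => hq.1 i, fun i => ?_⟩
    exact (Finset.single_le_sum (fun j _ => hq.1 j) (Finset.mem_univ i)).trans hq.2

lemma measurableSet_solidSimplex (d : ℕ) : MeasurableSet (solidSimplex d) :=
  (isCompact_solidSimplex d).measurableSet

/-- Outside the solid simplex one of the factors vanishes. -/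
lemma prod_truncPow_cons {d : ℕ} (k : Fin (d + 1) → ℕ) (q : Fin d → ℝ) :
    (∏ i : Fin d, truncPow (k i.succ) (q i)) * truncPow (k 0) (1 - ∑ i, q i)
      = (solidSimplex d).indicator (fun q => ENNReal.ofReal
        (∏ j, (Fin.cons (1 - ∑ i, q i) q : Fin (d + 1) → ℝ) j ^ k j / (k j).factorial)) q := by
  by_cases hq : q ∈ solidSimplex d
  · have h0 : 0 ≤ 1 - ∑ i, q i := sub_nonneg.mpr hq.2
    rw [Set.indicator_of_mem hq, Fin.prod_univ_succ, ENNReal.ofReal_mul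
      (by simp only [Fin.cons_zero]; positivity), mul_comm, ENNReal.ofReal_prod_of_nonneg]
    · simp only [truncPow, Fin.cons_zero, Fin.cons_succ, h0, hq.1, if_true]
    · intro i _
      have := hq.1 i
      simp only [Fin.cons_succ]
      positivity
  · rw [Set.indicator_of_notMem hq]
    by_cases h : ∀ i, 0 ≤ q i
    · have h0 : ¬ ∑ i, q i ≤ 1 := fun h1 => hq ⟨h, h1⟩
      simp [truncPow, h0]
    · push Not at h
      obtain ⟨i, hi⟩ := h
      rw [Finset.prod_eq_zero (Finset.mem_univ i), zero_mul]
      simp [truncPow, not_le.mpr hi]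

lemma volume_solidSimplex (d : ℕ) :
    volume (solidSimplex d) = ENNReal.ofReal (1 / d.factorial) := by
  have h := lintegral_prod_truncPow (fun _ : Fin d => 0) 0 1
  have h2 := fun q => prod_truncPow_cons (fun _ : Fin (d + 1) => 0) q
  simp only [h2] at h
  rw [lintegral_indicator (measurableSet_solidSimplex d)] at h
  simpa [truncPow] using h

instance isProbabilityMeasure_cond_solidSimplex (d : ℕ) : IsProbabilityMeasure
    (ProbabilityTheory.cond (volume : Measure (Fin d → ℝ)) (solidSimplex d)) := by
  refine ProbabilityTheory.cond_isProbabilityMeasure_of_finite ?_ ?_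
  · rw [volume_solidSimplex]
    exact (ENNReal.ofReal_pos.mpr (by positivity)).ne'
  · rw [volume_solidSimplex]
    exact ENNReal.ofReal_ne_top

lemma measurable_simplex_coord (d : ℕ) : Measurable
    fun q : Fin d → ℝ => (Fin.cons (1 - ∑ i, q i) q : Fin (d + 1) → ℝ) := by
  refine measurable_pi_lambda _ fun j => ?_
  refine Fin.cases ?_ (fun i => ?_) j
  · simp only [Fin.cons_zero]; fun_prop
  · simp only [Fin.cons_succ]; fun_prop

instance isProbabilityMeasure_simplexMeasure (d : ℕ) :
    IsProbabilityMeasure (simplexMeasure d) :=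
  Measure.isProbabilityMeasure_map (measurable_simplex_coord d).aemeasurable

lemma ae_mem_stdSimplex (d : ℕ) :
    ∀ᵐ p ∂simplexMeasure d, p ∈ stdSimplex ℝ (Fin (d + 1)) := by
  refine (ae_map_iff (measurable_simplex_coord d).aemeasurable
    (isClosed_stdSimplex (𝕜 := ℝ) (Fin (d + 1))).measurableSet).mpr ?_
  refine (ProbabilityTheory.ae_cond_mem (measurableSet_solidSimplex d)).mono fun q hq => ?_
  refine ⟨fun j => ?_, ?_⟩
  · refine Fin.cases ?_ (fun i => ?_) j
    · simpa using hq.2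
    · simpa using hq.1 i
  · simp [Fin.sum_univ_succ]

/-- The moments of the flat Dirichlet distribution. -/
lemma integral_prod_pow_simplexMeasure {d : ℕ} (k : Fin (d + 1) → ℕ) :
    ∫ p, ∏ j, p j ^ k j ∂simplexMeasure d
      = (∏ j, ((k j).factorial : ℝ)) * (d.factorial / (∑ j, k j + d).factorial) := by
  have hk : (∏ j, ((k j).factorial : ℝ)) ≠ 0 :=
    Finset.prod_ne_zero_iff.mpr fun j _ => by positivity
  have h1 : ∫ p, ∏ j, p j ^ k j / (k j).factorial ∂simplexMeasure d
      = d.factorial / (∑ j, k j + d).factorial := by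
    rw [integral_eq_lintegral_of_nonneg_ae]
    · rw [simplexMeasure, lintegral_map (by fun_prop) (measurable_simplex_coord d),
        ProbabilityTheory.cond, lintegral_smul_measure,
        ← lintegral_indicator (measurableSet_solidSimplex d)]
      simp_rw [← prod_truncPow_cons k]
      rw [lintegral_prod_truncPow, volume_solidSimplex, Fin.sum_univ_succ,
        add_comm (k 0)]
      simp only [truncPow, zero_le_one, if_true, one_pow, smul_eq_mul, ENNReal.toReal_mul,
        ENNReal.toReal_inv]
      rw [ENNReal.toReal_ofReal (by positivity), ENNReal.toReal_ofReal (by positivity)]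
      field_simp
    · refine (ae_mem_stdSimplex d).mono fun p hp => ?_
      exact Finset.prod_nonneg fun j _ => div_nonneg (pow_nonneg (hp.1 j) _) (by positivity)
    · exact Measurable.aestronglyMeasurable (by fun_prop)
  simp_rw [Finset.prod_div_distrib] at h1
  rw [integral_div, div_eq_iff hk] at h1
  rw [h1, mul_comm]

/-! ### Integrals over the phases -/

lemma phase_volume_ne_zero : volume (Set.Ico (0 : ℝ) (2 * Real.pi)) ≠ 0 := by
  simp [Real.pi_pos]

instance isProbabilityMeasure_cond_phase : IsProbabilityMeasure
    (ProbabilityTheory.cond (volume : Measure ℝ) (Set.Ico 0 (2 * Real.pi))) :=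
  ProbabilityTheory.cond_isProbabilityMeasure_of_finite phase_volume_ne_zero
    measure_Ico_lt_top.ne

instance isProbabilityMeasure_phaseMeasure (d : ℕ) :
    IsProbabilityMeasure (phaseMeasure d) := by
  unfold phaseMeasure; infer_instance

lemma integral_phase (a b : ℕ) :
    ∫ t : ℝ, Complex.exp (Complex.I * t) ^ a * (starRingEnd ℂ) (Complex.exp (Complex.I * t)) ^ b
      ∂(ProbabilityTheory.cond (volume : Measure ℝ) (Set.Ico 0 (2 * Real.pi)))
      = if a = b then 1 else 0 := by
  have he : ∀ t : ℝ, Complex.exp (Complex.I * t) ^ a *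
      (starRingEnd ℂ) (Complex.exp (Complex.I * t)) ^ b
      = Complex.exp ((((a : ℂ) - b) * Complex.I) * t) := by
    intro t
    rw [← Complex.exp_conj, ← Complex.exp_nat_mul, ← Complex.exp_nat_mul, ← Complex.exp_add]
    congr 1
    simp
    ring
  simp_rw [he]
  split_ifs with h
  · simp [h]
  · have hc : (((a : ℂ) - b) * Complex.I) ≠ 0 := by
      refine mul_ne_zero (sub_ne_zero.mpr ?_) Complex.I_ne_zero
      exact_mod_cast h
    rw [ProbabilityTheory.cond, integral_smul_measure, integral_Ico_eq_integral_Ioc,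
      ← intervalIntegral.integral_of_le (by positivity), integral_exp_mul_complex hc]
    have : Complex.exp ((((a : ℂ) - b) * Complex.I) * ((2 * Real.pi : ℝ) : ℂ)) = 1 := by
      rw [Complex.exp_eq_one_iff]
      refine ⟨(a : ℤ) - b, ?_⟩
      push_cast
      ring
    rw [this]
    simp

/-! ### Coherent states resolve the symmetric projector -/

/-- The parameter measure `λ_d ⊗ σ` of the states `v(p, θ)`. -/
def stateMeasure (d : ℕ) : Measure ((Fin (d + 1) → ℝ) × (Fin (d + 1) → ℝ)) :=
  (simplexMeasure d).prod (phaseMeasure d)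

instance isProbabilityMeasure_stateMeasure (d : ℕ) : IsProbabilityMeasure (stateMeasure d) := by
  unfold stateMeasure; infer_instance

lemma ae_phase_mem (d : ℕ) :
    ∀ᵐ θ ∂phaseMeasure d, θ ∈ Set.Icc (0 : Fin (d + 1) → ℝ) (fun _ => 2 * Real.pi) := by
  have h : ∀ j : Fin (d + 1), ∀ᵐ t ∂(ProbabilityTheory.cond (volume : Measure ℝ)
      (Set.Ico 0 (2 * Real.pi))), t ∈ Set.Icc (0 : ℝ) (2 * Real.pi) := fun _ =>
    (ProbabilityTheory.ae_cond_mem measurableSet_Ico).mono fun t ht => ⟨ht.1, ht.2.le⟩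
  have h2 : ∀ᵐ θ ∂phaseMeasure d, ∀ j, θ j ∈ Set.Icc (0 : ℝ) (2 * Real.pi) :=
    ae_all_iff.mpr fun j => (measurePreserving_eval _ j).quasiMeasurePreserving.ae (h j)
  exact h2.mono fun θ hθ => ⟨fun j => (hθ j).1, fun j => (hθ j).2⟩

lemma ae_fst_mem_stdSimplex (d : ℕ) :
    ∀ᵐ w ∂stateMeasure d, w.1 ∈ stdSimplex ℝ (Fin (d + 1)) :=
  Measure.quasiMeasurePreserving_fst.ae (ae_mem_stdSimplex d)

/-- The parameter measure lives on a compact set, so continuous functions are integrable. -/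
lemma integrable_of_continuous {d : ℕ} {E : Type*} [NormedAddCommGroup E]
    {f : (Fin (d + 1) → ℝ) × (Fin (d + 1) → ℝ) → E} (hf : Continuous f) :
    Integrable f (stateMeasure d) := by
  let K : Set ((Fin (d + 1) → ℝ) × (Fin (d + 1) → ℝ)) :=
    stdSimplex ℝ (Fin (d + 1)) ×ˢ Set.Icc (0 : Fin (d + 1) → ℝ) (fun _ => 2 * Real.pi)
  have hK : IsCompact K := (isCompact_stdSimplex ℝ (Fin (d + 1))).prod isCompact_Icc
  have hae : ∀ᵐ w ∂stateMeasure d, w ∈ K := by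
    filter_upwards [ae_fst_mem_stdSimplex d,
      Measure.quasiMeasurePreserving_snd.ae (ae_phase_mem d)] with w h1 h2
    exact ⟨h1, h2⟩
  have h := hf.continuousOn.integrableOn_compact (μ := stateMeasure d) hK
  rwa [IntegrableOn, Measure.restrict_eq_self_of_ae_mem hae] at h

lemma continuous_vec {d : ℕ} (j : Fin (d + 1)) :
    Continuous fun w : (Fin (d + 1) → ℝ) × (Fin (d + 1) → ℝ) => vec w.1 w.2 j := by
  unfold vec
  fun_prop

/-- The coordinates of the product vector `v ⊗ ⋯ ⊗ v`. -/
def productVec {d : ℕ} (v : Fin (d + 1) → ℂ) (n : ℕ) : Cfg d n → ℂ := fun x => ∏ k, v (x k)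

/-- The occupation number of the state `j` in the configuration `x`. -/
def occ {d n : ℕ} (x : Cfg d n) (j : Fin (d + 1)) : ℕ := Fintype.card {k // x k = j}

lemma sum_occ {d n : ℕ} (x : Cfg d n) : ∑ j, occ x j = n := by
  have h := Fintype.card_congr (Equiv.sigmaFiberEquiv x)
  rw [Fintype.card_sigma] at h
  simpa [occ] using h

lemma productVec_eq_prod_pow {d n : ℕ} (v : Fin (d + 1) → ℂ) (x : Cfg d n) :
    productVec v n x = ∏ j, v j ^ occ x j := by
  rw [productVec, ← Fintype.prod_fiberwise' x v]
  simp [occ]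

lemma continuous_productVec {d n : ℕ} (x : Cfg d n) :
    Continuous fun w : (Fin (d + 1) → ℝ) × (Fin (d + 1) → ℝ) =>
      productVec (vec w.1 w.2) n x :=
  continuous_finsetProd _ fun k _ => continuous_vec (x k)

lemma integral_productVec_mul_conj {d n : ℕ} (x y : Cfg d n) :
    ∫ w, productVec (vec w.1 w.2) n x * (starRingEnd ℂ) (productVec (vec w.1 w.2) n y)
      ∂stateMeasure d
      = if occ x = occ y then
          (∏ j, ((occ x j).factorial : ℂ)) * (d.factorial / (n + d).factorial) else 0 := by
  rw [stateMeasure, integral_prod]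
  · have hin : ∀ p : Fin (d + 1) → ℝ, ∫ θ, productVec (vec p θ) n x *
        (starRingEnd ℂ) (productVec (vec p θ) n y) ∂phaseMeasure d
        = if occ x = occ y then ((∏ j, (Real.sqrt (p j) * Real.sqrt (p j)) ^ occ x j : ℝ) : ℂ)
          else 0 := by
      intro p
      have h1 : ∀ θ : Fin (d + 1) → ℝ, productVec (vec p θ) n x *
          (starRingEnd ℂ) (productVec (vec p θ) n y)
          = (∏ j, ((Real.sqrt (p j) : ℂ) ^ occ x j * (Real.sqrt (p j) : ℂ) ^ occ y j)) *
            ∏ j, (Complex.exp (Complex.I * (θ j : ℝ)) ^ occ x j *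
              (starRingEnd ℂ) (Complex.exp (Complex.I * (θ j : ℝ))) ^ occ y j) := by
        intro θ
        rw [productVec_eq_prod_pow, productVec_eq_prod_pow, map_prod, ← Finset.prod_mul_distrib,
          ← Finset.prod_mul_distrib]
        refine Finset.prod_congr rfl fun j _ => ?_
        simp only [vec, map_pow, map_mul, Complex.conj_ofReal]
        ring
      simp_rw [h1]
      rw [integral_const_mul, phaseMeasure, integral_fintype_prod_eq_prod
        (fun j (t : ℝ) => Complex.exp (Complex.I * t) ^ occ x j *
          (starRingEnd ℂ) (Complex.exp (Complex.I * t)) ^ occ y j)]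
      simp_rw [integral_phase]
      split_ifs with h
      · simp [h, mul_pow]
      · obtain ⟨j, hj⟩ := Function.ne_iff.mp h
        have h0 : ∏ j, (if occ x j = occ y j then (1 : ℂ) else 0) = 0 :=
          Finset.prod_eq_zero (Finset.mem_univ j) (if_neg hj)
        rw [h0, mul_zero]
    simp_rw [hin]
    split_ifs with h
    · have hae : ∀ᵐ p ∂simplexMeasure d, (∏ j, (Real.sqrt (p j) * Real.sqrt (p j)) ^ occ x j : ℝ)
          = ∏ j, p j ^ occ x j := by
        filter_upwards [ae_mem_stdSimplex d] with p hp
        exact Finset.prod_congr rfl fun j _ => by rw [Real.mul_self_sqrt (hp.1 j)]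
      rw [integral_complex_ofReal, integral_congr_ae hae, integral_prod_pow_simplexMeasure,
        sum_occ]
      push_cast
      rfl
    · simp
  · exact integrable_of_continuous
      ((continuous_productVec x).mul (Complex.continuous_conj.comp (continuous_productVec y)))

lemma card_perm_comp_eq {d n : ℕ} (x y : Cfg d n) :
    Fintype.card {π : Equiv.Perm (Fin n) // x = fun k => y (π k)}
      = if occ x = occ y then ∏ j, (occ x j).factorial else 0 := by
  split_ifs with h
  -- if one permutation relates `x` and `y`, all of them form a coset of the stabilizer of `x`
  · let σ : Equiv.Perm (Fin n) := Equiv.ofFiberEquiv (f := x) (g := y)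
      fun c => Fintype.equivOfCardEq (congrFun h c)
    have hσ : ∀ k, y (σ k) = x k := fun k => Equiv.ofFiberEquiv_map _ k
    have e : {g : Equiv.Perm (Fin n) // x ∘ g = x} ≃
        {π : Equiv.Perm (Fin n) // x = fun k => y (π k)} :=
      (Equiv.mulLeft σ).subtypeEquiv fun g => by
        simp [hσ, funext_iff, eq_comm]
    rw [← Fintype.card_congr e]
    exact DomMulAct.stabilizer_card x
  · rw [Fintype.card_eq_zero_iff]
    refine ⟨fun π => h (funext fun j => ?_)⟩
    obtain ⟨π, hπ⟩ := π
    refine Fintype.card_congr (π.subtypeEquiv fun k => ?_)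
    rw [hπ]

/-- `Σ_n` is a positive multiple of the average of the projectors onto `v ⊗ ⋯ ⊗ v`. -/
lemma symProj_apply {d n : ℕ} (x y : Cfg d n) :
    symProj d n x y = ((n + d).factorial / (n.factorial * d.factorial) : ℂ) *
      ∫ w, productVec (vec w.1 w.2) n x * (starRingEnd ℂ) (productVec (vec w.1 w.2) n y)
        ∂stateMeasure d := by
  have h : symProj d n x y = (n.factorial : ℂ)⁻¹ *
      (Fintype.card {π : Equiv.Perm (Fin n) // x = fun k => y (π k)} : ℂ) := by
    rw [symProj, Matrix.smul_apply, Matrix.sum_apply, Fintype.card_subtype]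
    simp [permOp]
  rw [h, integral_productVec_mul_conj, card_perm_comp_eq]
  have h1 : ((n + d).factorial : ℂ) ≠ 0 := by exact_mod_cast (n + d).factorial_ne_zero
  have h2 : (d.factorial : ℂ) ≠ 0 := by exact_mod_cast d.factorial_ne_zero
  have h3 : (n.factorial : ℂ) ≠ 0 := by exact_mod_cast n.factorial_ne_zero
  split_ifs
  · push_cast
    field_simp
  · simp

open scoped Matrix.Norms.L2Operator

/-! ### Two-body operators: norm bounds -/

lemma l2_opNorm_mulVec_toLp {ι : Type*} [Fintype ι] [DecidableEq ι] (A : Matrix ι ι ℂ)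
    (f : ι → ℂ) : ‖WithLp.toLp 2 (A.mulVec f)‖ ≤ ‖A‖ * ‖WithLp.toLp 2 f‖ :=
  A.l2_opNorm_mulVec (WithLp.toLp 2 f)

/-- Schur's test. -/
lemma l2_opNorm_le_of_row_col_sums {ι : Type*} [Fintype ι] [DecidableEq ι] (A : Matrix ι ι ℂ)
    {C : ℝ} (hC : 0 ≤ C) (hrow : ∀ x, ∑ y, ‖A x y‖ ≤ C) (hcol : ∀ y, ∑ x, ‖A x y‖ ≤ C) :
    ‖A‖ ≤ C := by
  rw [Matrix.l2_opNorm_def]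
  refine ContinuousLinearMap.opNorm_le_bound _ hC fun f => ?_
  have h : ‖WithLp.toLp 2 (A.mulVec f.ofLp)‖ ≤ C * ‖f‖ := by
    refine le_of_sq_le_sq ?_ (by positivity)
    rw [mul_pow, EuclideanSpace.norm_sq_eq, EuclideanSpace.norm_sq_eq]
    have h1 : ∀ x, ‖A.mulVec f.ofLp x‖ ^ 2 ≤ C * ∑ y, ‖A x y‖ * ‖f y‖ ^ 2 := by
      intro x
      calc ‖A.mulVec f.ofLp x‖ ^ 2 ≤ (∑ y, ‖A x y‖ * ‖f y‖) ^ 2 := by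
            gcongr
            refine (norm_sum_le _ _).trans (le_of_eq ?_)
            simp
        _ ≤ (∑ y, ‖A x y‖) * ∑ y, ‖A x y‖ * ‖f y‖ ^ 2 := by
            refine Finset.sum_sq_le_sum_mul_sum_of_sq_le_mul _ (fun _ _ => norm_nonneg _)
              (fun _ _ => by positivity) fun y _ => le_of_eq (by ring)
        _ ≤ C * ∑ y, ‖A x y‖ * ‖f y‖ ^ 2 := by
            gcongr
            exact hrow x
    calc ∑ x, ‖A.mulVec f.ofLp x‖ ^ 2 ≤ ∑ x, C * ∑ y, ‖A x y‖ * ‖f y‖ ^ 2 :=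
          Finset.sum_le_sum fun x _ => h1 x
      _ = C * ∑ y, (∑ x, ‖A x y‖) * ‖f y‖ ^ 2 := by
          rw [← Finset.mul_sum, Finset.sum_comm]
          simp_rw [Finset.sum_mul]
      _ ≤ C * ∑ y, C * ‖f y‖ ^ 2 := by
          gcongr with y
          exact hcol y
      _ = C ^ 2 * ∑ y, ‖f y‖ ^ 2 := by
          rw [← Finset.mul_sum]; ring
  exact h

variable {d n : ℕ}

/-- The operators on two particles. -/
abbrev PairOp (d : ℕ) : Type := Matrix (Fin (d + 1) × Fin (d + 1)) (Fin (d + 1) × Fin (d + 1)) ℂ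

lemma sum_ite_agree_off_pair {M : Type*} [AddCommMonoid M] {i j : Fin n} (hij : i ≠ j)
    (x : Cfg d n) (F : Cfg d n → M) :
    ∑ y, (if ∀ k, k ≠ i → k ≠ j → x k = y k then F y else 0)
      = ∑ q : Fin (d + 1) × Fin (d + 1),
          F (Function.update (Function.update x i q.1) j q.2) := by
  rw [← Finset.sum_filter]
  refine Finset.sum_nbij' (fun y => (y i, y j))
    (fun q => Function.update (Function.update x i q.1) j q.2) ?_ ?_ ?_ ?_ ?_
  · simp
  · intro q _
    simp +contextual
  · intro y hy
    rw [Finset.mem_filter] at hy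
    funext k
    by_cases hkj : k = j
    · subst hkj; simp
    · by_cases hki : k = i
      · subst hki; simp [hkj]
      · simp [hkj, hki, hy.2 k hki hkj]
  · intro q _
    simp [hij]
  · intro y hy
    rw [Finset.mem_filter] at hy
    congr 1
    funext k
    by_cases hkj : k = j
    · subst hkj; simp
    · by_cases hki : k = i
      · subst hki; simp [hkj]
      · simp [hkj, hki, hy.2 k hki hkj]

/-- A sum over configurations vanishes if it does so after summing over two coordinates only. -/
lemma sum_eq_zero_of_pair_sum {i j : Fin n} (hij : i ≠ j) (F : Cfg d n → ℂ)
    (h : ∀ x : Cfg d n, ∑ q : Fin (d + 1) × Fin (d + 1),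
      F (Function.update (Function.update x i q.1) j q.2) = 0) : ∑ x, F x = 0 := by
  have h1 : ∑ x : Cfg d n, ∑ y : Cfg d n,
      (if ∀ k, k ≠ i → k ≠ j → x k = y k then F y else 0) = 0 :=
    Finset.sum_eq_zero fun x _ => by rw [sum_ite_agree_off_pair hij, h]
  rw [Finset.sum_comm] at h1
  have h2 : ∀ y : Cfg d n, ∑ x : Cfg d n,
      (if ∀ k, k ≠ i → k ≠ j → x k = y k then F y else 0)
        = ((d + 1) * (d + 1) : ℂ) * F y := by
    intro y
    simp_rw [eq_comm (b := y _)]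
    rw [sum_ite_agree_off_pair hij y (fun _ => F y)]
    simp
  simp_rw [h2, ← Finset.mul_sum] at h1
  refine (mul_eq_zero.mp h1).resolve_left ?_
  have : ((d : ℂ) + 1) ≠ 0 := by exact_mod_cast d.succ_ne_zero
  exact mul_ne_zero this this

/-- The sum of the moduli of the entries, an upper bound for the operator norm. -/
def entrySum (W : PairOp d) : ℝ := ∑ p, ∑ q, ‖W p q‖

lemma entrySum_nonneg (W : PairOp d) : 0 ≤ entrySum W :=
  Finset.sum_nonneg fun _ _ => Finset.sum_nonneg fun _ _ => norm_nonneg _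

lemma norm_twoBody_le (W : PairOp d) {i j : Fin n} (hij : i ≠ j) :
    ‖(twoBody W i j : Op d n)‖ ≤ entrySum W := by
  refine l2_opNorm_le_of_row_col_sums _ (entrySum_nonneg W) (fun x => ?_) fun y => ?_
  · have h : ∀ y : Cfg d n, ‖(twoBody W i j : Op d n) x y‖
        = if ∀ k, k ≠ i → k ≠ j → x k = y k then ‖W (x i, x j) (y i, y j)‖ else 0 := by
      intro y
      simp only [twoBody, Matrix.of_apply]
      split_ifs <;> simp
    simp_rw [h]
    rw [sum_ite_agree_off_pair hij x (fun y => ‖W (x i, x j) (y i, y j)‖)]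
    simp only [Function.update_self, Function.update_of_ne hij]
    exact Finset.single_le_sum (f := fun p => ∑ q, ‖W p q‖)
      (fun _ _ => Finset.sum_nonneg fun _ _ => norm_nonneg _) (Finset.mem_univ (x i, x j))
  · have h : ∀ x : Cfg d n, ‖(twoBody W i j : Op d n) x y‖
        = if ∀ k, k ≠ i → k ≠ j → y k = x k then ‖W (x i, x j) (y i, y j)‖ else 0 := by
      intro x
      simp only [twoBody, Matrix.of_apply, eq_comm (a := x _)]
      split_ifs <;> simp
    simp_rw [h]
    rw [sum_ite_agree_off_pair hij y (fun x => ‖W (x i, x j) (y i, y j)‖), entrySum,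
      Finset.sum_comm]
    simp only [Function.update_self, Function.update_of_ne hij]
    exact Finset.single_le_sum (f := fun q => ∑ p, ‖W p q‖)
      (fun _ _ => Finset.sum_nonneg fun _ _ => norm_nonneg _) (Finset.mem_univ (y i, y j))

/-! ### Fluctuations of two-body operators in product states -/

lemma productVec_update_update (v : Fin (d + 1) → ℂ) {i j : Fin n} (hij : i ≠ j) (x : Cfg d n)
    (a b : Fin (d + 1)) :
    productVec v n (Function.update (Function.update x i a) j b)
      = v a * v b * ∏ k ∈ (Finset.univ.erase i).erase j, v (x k) := by
  rw [productVec, ← Finset.mul_prod_erase _ _ (Finset.mem_univ i), ← Finset.mul_prod_erase _ _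
    (Finset.mem_erase.mpr ⟨hij.symm, Finset.mem_univ j⟩), ← mul_assoc]
  simp only [Function.update_self, Function.update_of_ne hij]
  congr 1
  refine Finset.prod_congr rfl fun k hk => ?_
  simp only [Finset.mem_erase] at hk
  rw [Function.update_of_ne hk.1, Function.update_of_ne hk.2.1]

/-- The vector `W (v ⊗ v)`. -/
def pairVec (W : PairOp d) (v : Fin (d + 1) → ℂ) (p : Fin (d + 1) × Fin (d + 1)) : ℂ :=
  ∑ q : Fin (d + 1) × Fin (d + 1), W p q * (v q.1 * v q.2)

lemma twoBody_mulVec_productVec (W : PairOp d) (v : Fin (d + 1) → ℂ) {i j : Fin n} (hij : i ≠ j)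
    (x : Cfg d n) :
    (twoBody W i j : Op d n).mulVec (productVec v n) x
      = pairVec W v (x i, x j) * ∏ k ∈ (Finset.univ.erase i).erase j, v (x k) := by
  have h : ∀ y : Cfg d n, (twoBody W i j : Op d n) x y * productVec v n y
      = if ∀ k, k ≠ i → k ≠ j → x k = y k
        then W (x i, x j) (y i, y j) * productVec v n y else 0 := by
    intro y
    simp only [twoBody, Matrix.of_apply, ite_mul, zero_mul]
  rw [Matrix.mulVec, dotProduct]
  simp_rw [h]
  rw [sum_ite_agree_off_pair hij x (fun y => W (x i, x j) (y i, y j) * productVec v n y)]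
  simp only [Function.update_self, Function.update_of_ne hij, productVec_update_update v hij,
    pairVec, Finset.sum_mul, mul_assoc]

/-- Two-body fluctuations over disjoint pairs of particles are uncorrelated. -/
lemma sum_conj_twoBody_mul_twoBody_eq_zero (W : PairOp d) (v : Fin (d + 1) → ℂ)
    (hW : ∑ p : Fin (d + 1) × Fin (d + 1),
      (starRingEnd ℂ) (v p.1 * v p.2) * pairVec W v p = 0)
    {i j k l : Fin n} (hij : i ≠ j) (hkl : k ≠ l) (hki : k ≠ i) (hkj : k ≠ j) (hli : l ≠ i)
    (hlj : l ≠ j) :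
    ∑ x, (starRingEnd ℂ) ((twoBody W k l : Op d n).mulVec (productVec v n) x) *
      (twoBody W i j : Op d n).mulVec (productVec v n) x = 0 := by
  refine sum_eq_zero_of_pair_sum hij _ fun x => ?_
  have hmi : i ∈ (Finset.univ.erase k).erase l := by simp [hki.symm, hli.symm]
  have hmj : j ∈ ((Finset.univ.erase k).erase l).erase i := by
    simp [hij.symm, hkj.symm, hlj.symm]
  have h1 : ∀ q : Fin (d + 1) × Fin (d + 1), (twoBody W k l : Op d n).mulVec (productVec v n)
      (Function.update (Function.update x i q.1) j q.2)
      = (v q.1 * v q.2) * (pairVec W v (x k, x l) *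
        ∏ r ∈ (((Finset.univ.erase k).erase l).erase i).erase j, v (x r)) := by
    intro q
    rw [twoBody_mulVec_productVec W v hkl, ← Finset.mul_prod_erase _ _ hmi,
      ← Finset.mul_prod_erase _ _ hmj]
    simp only [Function.update_self, Function.update_of_ne hij, Function.update_of_ne hki,
      Function.update_of_ne hkj, Function.update_of_ne hli, Function.update_of_ne hlj]
    have h2 : ∏ r ∈ (((Finset.univ.erase k).erase l).erase i).erase j,
        v (Function.update (Function.update x i q.1) j q.2 r)
        = ∏ r ∈ (((Finset.univ.erase k).erase l).erase i).erase j, v (x r) := by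
      refine Finset.prod_congr rfl fun r hr => ?_
      simp only [Finset.mem_erase] at hr
      rw [Function.update_of_ne hr.1, Function.update_of_ne hr.2.1]
    rw [h2]
    ring
  have h3 : ∀ q : Fin (d + 1) × Fin (d + 1), (twoBody W i j : Op d n).mulVec (productVec v n)
      (Function.update (Function.update x i q.1) j q.2)
      = pairVec W v q * ∏ r ∈ (Finset.univ.erase i).erase j, v (x r) := by
    intro q
    rw [twoBody_mulVec_productVec W v hij]
    simp only [Function.update_self, Function.update_of_ne hij]
    congr 1
    refine Finset.prod_congr rfl fun r hr => ?_
    simp only [Finset.mem_erase] at hr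
    rw [Function.update_of_ne hr.1, Function.update_of_ne hr.2.1]
  simp_rw [h1, h3]
  calc _ = (∑ p : Fin (d + 1) × Fin (d + 1),
        (starRingEnd ℂ) (v p.1 * v p.2) * pairVec W v p) *
        ((starRingEnd ℂ) (pairVec W v (x k, x l) *
          ∏ r ∈ (((Finset.univ.erase k).erase l).erase i).erase j, v (x r)) *
          ∏ r ∈ (Finset.univ.erase i).erase j, v (x r)) := by
        rw [Finset.sum_mul]
        refine Finset.sum_congr rfl fun q _ => ?_
        rw [map_mul (starRingEnd ℂ) (v q.1 * v q.2)]
        ring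
    _ = 0 := by rw [hW, zero_mul]

/-- The pairs `i < j` of particles. -/
def pairs (n : ℕ) : Finset (Fin n × Fin n) := Finset.univ.filter fun p => p.1 < p.2

lemma sum_sum_filter_lt {M : Type*} [AddCommMonoid M] (f : Fin n → Fin n → M) :
    ∑ i : Fin n, ∑ j ∈ Finset.univ.filter (fun j : Fin n => i < j), f i j
      = ∑ p ∈ pairs n, f p.1 p.2 := by
  simp [pairs, Finset.sum_filter, Fintype.sum_prod_type]

lemma sum_pairs_add {M : Type*} [AddCommGroup M] (f : Fin n → M) :
    ∑ p ∈ pairs n, (f p.1 + f p.2) = n • ∑ i, f i - ∑ i, f i := by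
  have h : ∑ i : Fin n, ∑ j : Fin n, (if i ≠ j then f i else 0)
      = n • ∑ i, f i - ∑ i, f i := by
    have h1 : ∀ i j : Fin n, (if i ≠ j then f i else 0) = f i - if i = j then f i else 0 := by
      intro i j
      split_ifs <;> simp_all
    simp_rw [h1, Finset.sum_sub_distrib]
    simp [Finset.sum_const, ← Finset.smul_sum]
  rw [← h, Finset.sum_add_distrib, ← sum_sum_filter_lt (fun i _ => f i),
    ← sum_sum_filter_lt (fun _ j => f j)]
  simp_rw [Finset.sum_filter]
  rw [Finset.sum_comm (f := fun i j => if i < j then f j else 0), ← Finset.sum_add_distrib]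
  refine Finset.sum_congr rfl fun i _ => ?_
  rw [← Finset.sum_add_distrib]
  refine Finset.sum_congr rfl fun j _ => ?_
  rcases lt_trichotomy i j with hlt | heq | hgt
  · simp [hlt, hlt.ne, hlt.not_gt]
  · simp [heq]
  · simp [hgt, hgt.ne', hgt.not_gt]

lemma two_mul_card_pairs (n : ℕ) : (2 : ℝ) * (pairs n).card = n * (n - 1) := by
  have h := sum_pairs_add (n := n) (fun _ => (1 : ℝ))
  simp at h
  linarith

/-- Only `O(n³)` of the pairs of pairs have a particle in common. -/
lemma norm_sq_sum_pairs_le {C : ℝ} (u : Fin n × Fin n → EuclideanSpace ℂ (Cfg d n))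
    (hu : ∀ p ∈ pairs n, ‖u p‖ ≤ C)
    (horth : ∀ p ∈ pairs n, ∀ q ∈ pairs n, q.1 ≠ p.1 → q.1 ≠ p.2 → q.2 ≠ p.1 → q.2 ≠ p.2 →
      inner ℂ (u q) (u p) = 0) :
    ‖∑ p ∈ pairs n, u p‖ ^ 2 ≤ 4 * n ^ 3 * C ^ 2 := by
  let I : Fin n → Fin n → ℝ := fun i j => if i = j then 1 else 0
  have hI : ∀ i j, 0 ≤ I i j := fun i j => by simp only [I]; split_ifs <;> norm_num
  have hb : ∀ p ∈ pairs n, ∀ q ∈ pairs n, ‖inner ℂ (u q) (u p)‖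
      ≤ (I q.1 p.1 + I q.1 p.2 + I q.2 p.1 + I q.2 p.2) * C ^ 2 := by
    intro p hp q hq
    have h0 := hI q.1 p.1
    have h1 := hI q.1 p.2
    have h2 := hI q.2 p.1
    have h3 := hI q.2 p.2
    by_cases h : q.1 ≠ p.1 ∧ q.1 ≠ p.2 ∧ q.2 ≠ p.1 ∧ q.2 ≠ p.2
    · rw [horth p hp q hq h.1 h.2.1 h.2.2.1 h.2.2.2, norm_zero]
      positivity
    · have hone : 1 ≤ I q.1 p.1 + I q.1 p.2 + I q.2 p.1 + I q.2 p.2 := by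
        have : I q.1 p.1 = 1 ∨ I q.1 p.2 = 1 ∨ I q.2 p.1 = 1 ∨ I q.2 p.2 = 1 := by
          simp only [I]
          grind
        rcases this with h | h | h | h <;> linarith
      have hC : 0 ≤ C := (norm_nonneg _).trans (hu p hp)
      calc ‖inner ℂ (u q) (u p)‖ ≤ ‖u q‖ * ‖u p‖ := norm_inner_le_norm _ _
        _ ≤ C * C := by
          gcongr
          · exact hu q hq
          · exact hu p hp
        _ = 1 * C ^ 2 := by ring
        _ ≤ _ := by gcongr
  have hs : ‖∑ p ∈ pairs n, u p‖ ^ 2 ≤ ∑ p ∈ pairs n, ∑ q ∈ pairs n, ‖inner ℂ (u q) (u p)‖ := by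
    have h1 := inner_self_eq_norm_sq_to_K (𝕜 := ℂ) (∑ p ∈ pairs n, u p)
    have h2 : ‖∑ p ∈ pairs n, u p‖ ^ 2
        = ‖(inner ℂ (∑ p ∈ pairs n, u p) (∑ p ∈ pairs n, u p) : ℂ)‖ := by
      rw [h1]; simp
    rw [h2, inner_sum]
    refine (norm_sum_le _ _).trans (Finset.sum_le_sum fun p _ => ?_)
    rw [sum_inner]
    exact norm_sum_le _ _
  refine hs.trans ?_
  calc ∑ p ∈ pairs n, ∑ q ∈ pairs n, ‖inner ℂ (u q) (u p)‖
      ≤ ∑ p ∈ pairs n, ∑ q ∈ pairs n,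
        (I q.1 p.1 + I q.1 p.2 + I q.2 p.1 + I q.2 p.2) * C ^ 2 :=
        Finset.sum_le_sum fun p hp => Finset.sum_le_sum fun q hq => hb p hp q hq
    _ ≤ ∑ p : Fin n × Fin n, ∑ q : Fin n × Fin n,
        (I q.1 p.1 + I q.1 p.2 + I q.2 p.1 + I q.2 p.2) * C ^ 2 := by
        have hnn : ∀ p q : Fin n × Fin n,
            0 ≤ (I q.1 p.1 + I q.1 p.2 + I q.2 p.1 + I q.2 p.2) * C ^ 2 := by
          intro p q
          have h0 := hI q.1 p.1
          have h1 := hI q.1 p.2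
          have h2 := hI q.2 p.1
          have h3 := hI q.2 p.2
          positivity
        refine (Finset.sum_le_sum fun p _ => Finset.sum_le_sum_of_subset_of_nonneg
          (Finset.subset_univ _) fun q _ _ => hnn p q).trans ?_
        exact Finset.sum_le_sum_of_subset_of_nonneg (Finset.subset_univ _)
          fun p _ _ => Finset.sum_nonneg fun q _ => hnn p q
    _ = 4 * n ^ 3 * C ^ 2 := by
        simp_rw [← Finset.sum_mul]
        congr 1
        have h1 : ∀ a : Fin n, ∑ q : Fin n × Fin n, I q.1 a = n := fun a => by
          rw [Fintype.sum_prod_type_right]; simp [I]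
        have h2 : ∀ a : Fin n, ∑ q : Fin n × Fin n, I q.2 a = n := fun a => by
          rw [Fintype.sum_prod_type]; simp [I]
        simp only [Finset.sum_add_distrib, h1, h2, Finset.sum_const, Finset.card_univ,
          Fintype.card_prod, Fintype.card_fin, nsmul_eq_mul]
        push_cast
        ring

/-! ### The Hamiltonian as a sum over pairs -/

/-- The symmetrized one-body part plus the interaction, as a single two-particle operator. -/
def pairHamiltonian (T : Matrix (Fin (d + 1)) (Fin (d + 1)) ℂ) (V : PairOp d) : PairOp d :=
  T ⊗ₖ (1 : Matrix (Fin (d + 1)) (Fin (d + 1)) ℂ) + (1 : Matrix (Fin (d + 1)) (Fin (d + 1)) ℂ) ⊗ₖ T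
    + V

lemma twoBody_add (V W : PairOp d) (i j : Fin n) :
    (twoBody (V + W) i j : Op d n) = twoBody V i j + twoBody W i j := by
  ext x y
  simp only [twoBody, Matrix.of_apply, Matrix.add_apply]
  split_ifs <;> simp

lemma twoBody_sub_smul_one (W : PairOp d) (c : ℂ) (i j : Fin n) :
    (twoBody (W - c • 1) i j : Op d n) = twoBody W i j - c • 1 := by
  ext x y
  simp only [twoBody, Matrix.of_apply, Matrix.sub_apply, Matrix.smul_apply, Matrix.one_apply]
  by_cases h : x = y
  · simp [h]
  · have h1 : (∀ k, k ≠ i → k ≠ j → x k = y k) → (x i, x j) ≠ (y i, y j) := by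
      intro h2 h3
      refine h (funext fun k => ?_)
      by_cases hi : k = i
      · rw [hi]; exact (Prod.ext_iff.mp h3).1
      · by_cases hj : k = j
        · rw [hj]; exact (Prod.ext_iff.mp h3).2
        · exact h2 k hi hj
    split_ifs <;> simp_all

lemma twoBody_kronecker_one (T : Matrix (Fin (d + 1)) (Fin (d + 1)) ℂ) {i j : Fin n}
    (hij : i ≠ j) : (twoBody (T ⊗ₖ 1) i j : Op d n) = oneBody T i := by
  ext x y
  simp only [twoBody, oneBody, Matrix.of_apply, Matrix.kroneckerMap_apply, Matrix.one_apply]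
  by_cases h : x j = y j
  · have : (∀ k, k ≠ i → k ≠ j → x k = y k) ↔ ∀ k, k ≠ i → x k = y k := by
      refine ⟨fun h1 k hk => ?_, fun h1 k hk _ => h1 k hk⟩
      by_cases hj : k = j
      · rw [hj, h]
      · exact h1 k hk hj
    simp [this, h]
  · have : ¬ ∀ k, k ≠ i → x k = y k := fun h1 => h (h1 j hij.symm)
    rw [if_neg this]
    simp [h]

lemma twoBody_one_kronecker (T : Matrix (Fin (d + 1)) (Fin (d + 1)) ℂ) {i j : Fin n}
    (hij : i ≠ j) : (twoBody (1 ⊗ₖ T) i j : Op d n) = oneBody T j := by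
  ext x y
  simp only [twoBody, oneBody, Matrix.of_apply, Matrix.kroneckerMap_apply, Matrix.one_apply]
  by_cases h : x i = y i
  · have : (∀ k, k ≠ i → k ≠ j → x k = y k) ↔ ∀ k, k ≠ j → x k = y k := by
      refine ⟨fun h1 k hk => ?_, fun h1 k _ hk => h1 k hk⟩
      by_cases hi : k = i
      · rw [hi, h]
      · exact h1 k hi hk
    simp [this, h]
  · have : ¬ ∀ k, k ≠ j → x k = y k := fun h1 => h (h1 i hij)
    rw [if_neg this]
    simp [h]

/-- Each particle belongs to `n - 1` pairs, which absorbs the one-body part into the pair sum. -/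
lemma hamiltonian_eq_sum_pairs (T : Matrix (Fin (d + 1)) (Fin (d + 1)) ℂ) (V : PairOp d)
    (hn : 2 ≤ n) : hamiltonian T V n
      = ((n : ℂ) - 1)⁻¹ • ∑ p ∈ pairs n, twoBody (pairHamiltonian T V) p.1 p.2 := by
  have hn1 : ((n : ℂ) - 1) ≠ 0 := by
    rw [sub_ne_zero]
    exact_mod_cast (by lia : n ≠ 1)
  have h : ∀ p ∈ pairs n, (twoBody (pairHamiltonian T V) p.1 p.2 : Op d n)
      = (oneBody T p.1 + oneBody T p.2) + twoBody V p.1 p.2 := by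
    intro p hp
    have hp' : p.1 ≠ p.2 := (Finset.mem_filter.mp hp).2.ne
    rw [pairHamiltonian, twoBody_add, twoBody_add, twoBody_kronecker_one T hp',
      twoBody_one_kronecker T hp']
  rw [Finset.sum_congr rfl h, Finset.sum_add_distrib, sum_pairs_add (fun i => oneBody T i),
    hamiltonian, sum_sum_filter_lt (fun i j => (twoBody V i j : Op d n)), smul_add]
  congr 1
  rw [← Nat.cast_smul_eq_nsmul ℂ, eq_inv_smul_iff₀ hn1, sub_smul, one_smul]

/-! ### Mean-field energies -/

/-- The expectation of the two-particle operator `W` in the state `v ⊗ v`. -/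
def pairEnergy (W : PairOp d) (v : Fin (d + 1) → ℂ) : ℂ := (W * (proj v ⊗ₖ proj v)).trace

lemma sum_conj_mul_pairVec (W : PairOp d) (v : Fin (d + 1) → ℂ) :
    ∑ p : Fin (d + 1) × Fin (d + 1), (starRingEnd ℂ) (v p.1 * v p.2) * pairVec W v p
      = pairEnergy W v := by
  simp only [pairEnergy, Matrix.trace, Matrix.diag, Matrix.mul_apply, pairVec, Finset.mul_sum,
    Matrix.kroneckerMap_apply, proj, Matrix.vecMulVec_apply, Pi.star_apply]
  refine Finset.sum_congr rfl fun p _ => Finset.sum_congr rfl fun q _ => ?_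
  simp
  ring

lemma sum_conj_mul_self {v : Fin (d + 1) → ℂ} (hv : ∑ j, ‖v j‖ ^ 2 = 1) :
    ∑ j, v j * (starRingEnd ℂ) (v j) = 1 := by
  simp_rw [Complex.mul_conj, Complex.normSq_eq_norm_sq]
  exact_mod_cast hv

lemma trace_proj {v : Fin (d + 1) → ℂ} (hv : ∑ j, ‖v j‖ ^ 2 = 1) : (proj v).trace = 1 := by
  rw [← sum_conj_mul_self hv]
  simp [Matrix.trace, proj, Matrix.vecMulVec_apply]

lemma pairEnergy_sub_smul_one (W : PairOp d) {v : Fin (d + 1) → ℂ} (hv : ∑ j, ‖v j‖ ^ 2 = 1)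
    (c : ℂ) : pairEnergy (W - c • 1) v = pairEnergy W v - c := by
  simp [pairEnergy, Matrix.sub_mul, Matrix.trace_kronecker, trace_proj hv]

lemma pairEnergy_pairHamiltonian (T : Matrix (Fin (d + 1)) (Fin (d + 1)) ℂ) (V : PairOp d)
    {v : Fin (d + 1) → ℂ} (hv : ∑ j, ‖v j‖ ^ 2 = 1) :
    pairEnergy (pairHamiltonian T V) v
      = 2 * (T * proj v).trace + (V * (proj v ⊗ₖ proj v)).trace := by
  simp only [pairEnergy, pairHamiltonian, Matrix.add_mul, ← Matrix.mul_kronecker_mul,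
    Matrix.trace_add, Matrix.trace_kronecker, Matrix.one_mul, trace_proj hv]
  ring

lemma norm_le_one_of_sum_sq {v : Fin (d + 1) → ℂ} (hv : ∑ j, ‖v j‖ ^ 2 = 1) (j : Fin (d + 1)) :
    ‖v j‖ ≤ 1 := by
  have h : ‖v j‖ ^ 2 ≤ 1 := by
    rw [← hv]
    exact Finset.single_le_sum (f := fun j => ‖v j‖ ^ 2) (fun _ _ => by positivity)
      (Finset.mem_univ j)
  exact (sq_le_one_iff₀ (norm_nonneg _)).mp h

lemma norm_pairEnergy_le (W : PairOp d) {v : Fin (d + 1) → ℂ} (hv : ∑ j, ‖v j‖ ^ 2 = 1) :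
    ‖pairEnergy W v‖ ≤ entrySum W := by
  have h1 := norm_le_one_of_sum_sq hv
  have h2 : ∀ p : Fin (d + 1) × Fin (d + 1), ‖v p.1 * v p.2‖ ≤ 1 := fun p => by
    rw [norm_mul]
    exact mul_le_one₀ (h1 _) (norm_nonneg _) (h1 _)
  rw [← sum_conj_mul_pairVec]
  refine (norm_sum_le _ _).trans (Finset.sum_le_sum fun p _ => ?_)
  rw [norm_mul, RCLike.norm_conj]
  refine (mul_le_of_le_one_left (norm_nonneg _) (h2 p)).trans ?_
  refine (norm_sum_le _ _).trans (Finset.sum_le_sum fun q _ => ?_)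
  rw [norm_mul]
  exact mul_le_of_le_one_right (norm_nonneg _) (h2 q)

lemma trace_mul_im_eq_zero {ι : Type*} [Fintype ι] {A B : Matrix ι ι ℂ} (hA : A.IsHermitian)
    (hB : B.IsHermitian) : (A * B).trace.im = 0 := by
  have h : (starRingEnd ℂ) (A * B).trace = (A * B).trace := by
    rw [starRingEnd_apply, ← Matrix.trace_conjTranspose, Matrix.conjTranspose_mul, hA.eq, hB.eq,
      Matrix.trace_mul_comm]
  exact Complex.conj_eq_iff_im.mp h

lemma isHermitian_proj (v : Fin (d + 1) → ℂ) : (proj v).IsHermitian := by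
  ext a b
  simp [proj, Matrix.vecMulVec_apply, mul_comm]

/-- The weight is defined through real parts of traces, which are real by Hermiticity. -/
lemma weight_eq_exp (T : Matrix (Fin (d + 1)) (Fin (d + 1)) ℂ) (hT : T.IsHermitian)
    (V : PairOp d) (hV : V.IsHermitian) (β : ℝ) {v : Fin (d + 1) → ℂ}
    (hv : ∑ j, ‖v j‖ ^ 2 = 1) :
    (weight T V β v : ℂ) = Complex.exp (-β * (pairEnergy (pairHamiltonian T V) v / 2)) := by
  have h1 := trace_mul_im_eq_zero hT (isHermitian_proj v)
  have hP : (proj v ⊗ₖ proj v).IsHermitian := by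
    rw [Matrix.IsHermitian, Matrix.conjTranspose_kronecker, (isHermitian_proj v).eq]
  have h2 := trace_mul_im_eq_zero hV hP
  rw [pairEnergy_pairHamiltonian T V hv, weight, Complex.ofReal_exp]
  congr 1
  have e1 : (T * proj v).trace = ((T * proj v).trace.re : ℂ) := Complex.ext rfl h1
  have e2 : (V * (proj v ⊗ₖ proj v)).trace = ((V * (proj v ⊗ₖ proj v)).trace.re : ℂ) :=
    Complex.ext rfl h2
  rw [e1, e2]
  push_cast
  simp only [Complex.ofReal_re]
  ring

/-! ### Concentration of the mean-field Hamiltonian in product states -/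

lemma norm_productVec {v : Fin (d + 1) → ℂ} (hv : ∑ j, ‖v j‖ ^ 2 = 1) (n : ℕ) :
    ‖WithLp.toLp 2 (productVec v n)‖ = 1 := by
  have h : ‖WithLp.toLp 2 (productVec v n)‖ ^ 2 = 1 := by
    rw [EuclideanSpace.norm_sq_eq]
    simp only [productVec, norm_prod, ← Finset.prod_pow]
    rw [← Fintype.sum_pow (fun j => ‖v j‖ ^ 2), hv, one_pow]
  exact (pow_eq_one_iff_of_nonneg (norm_nonneg _) two_ne_zero).mp h

/-- A bound for the norm of the centered two-particle operator `W - ⟨W⟩`, uniform in the state. -/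
def fluctBound (W : PairOp d) : ℝ := entrySum W * (1 + (d + 1) * (d + 1))

lemma fluctBound_nonneg (W : PairOp d) : 0 ≤ fluctBound W := by
  have := entrySum_nonneg W
  unfold fluctBound
  positivity

lemma entrySum_sub_smul_one_le (W : PairOp d) {c : ℂ} (hc : ‖c‖ ≤ entrySum W) :
    entrySum (W - c • 1) ≤ fluctBound W := by
  have h : ∀ p q, ‖(W - c • 1 : PairOp d) p q‖ ≤ ‖W p q‖ + if p = q then ‖c‖ else 0 := by
    intro p q
    rw [Matrix.sub_apply, Matrix.smul_apply, Matrix.one_apply]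
    refine (norm_sub_le _ _).trans ?_
    split_ifs <;> simp
  calc entrySum (W - c • 1) ≤ ∑ p, ∑ q, (‖W p q‖ + if p = q then ‖c‖ else 0) :=
        Finset.sum_le_sum fun p _ => Finset.sum_le_sum fun q _ => h p q
    _ = entrySum W + (d + 1) * (d + 1) * ‖c‖ := by
        simp [Finset.sum_add_distrib, entrySum]
    _ ≤ entrySum W + (d + 1) * (d + 1) * entrySum W := by gcongr
    _ = fluctBound W := by rw [fluctBound]; ring

/-- The fluctuation of the mean-field operator `(n (n-1))⁻¹ ∑_{i<j} W_{ij}` about half the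
expectation of `W` in the state `v ⊗ v`. -/
def fluct (W : PairOp d) (n : ℕ) (v : Fin (d + 1) → ℂ) : Op d n :=
  ((n : ℂ) * (n - 1))⁻¹ • ∑ p ∈ pairs n, twoBody (W - pairEnergy W v • 1) p.1 p.2

lemma norm_natCast_mul_sub_one (hn : 2 ≤ n) : ‖(n : ℂ) * (n - 1)‖ = n * (n - 1) := by
  have h : ((n : ℂ) * (n - 1)) = ((n * (n - 1) : ℝ) : ℂ) := by push_cast; ring
  have : (2 : ℝ) ≤ n := by exact_mod_cast hn
  rw [h, Complex.norm_real, Real.norm_of_nonneg]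
  nlinarith

lemma fluct_eq (W : PairOp d) (hn : 2 ≤ n) (v : Fin (d + 1) → ℂ) :
    fluct W n v = ((n : ℂ) * (n - 1))⁻¹ • (∑ p ∈ pairs n, (twoBody W p.1 p.2 : Op d n))
      - (pairEnergy W v / 2) • 1 := by
  have hc : (2 : ℂ) * (pairs n).card = n * (n - 1) := by
    have := two_mul_card_pairs n
    exact_mod_cast congrArg (fun r : ℝ => (r : ℂ)) this
  have hne : (n : ℂ) * (n - 1) ≠ 0 := by
    rw [← norm_pos_iff, norm_natCast_mul_sub_one hn]
    have : (2 : ℝ) ≤ n := by exact_mod_cast hn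
    nlinarith
  simp_rw [fluct, twoBody_sub_smul_one]
  rw [Finset.sum_sub_distrib, smul_sub, Finset.sum_const, ← Nat.cast_smul_eq_nsmul ℂ, smul_smul,
    smul_smul]
  congr 2
  rw [mul_assoc, inv_mul_eq_iff_eq_mul₀ hne, ← hc]
  ring

lemma norm_fluct_le (W : PairOp d) (hn : 2 ≤ n) {v : Fin (d + 1) → ℂ}
    (hv : ∑ j, ‖v j‖ ^ 2 = 1) : ‖fluct W n v‖ ≤ fluctBound W := by
  have hn' : (2 : ℝ) ≤ n := by exact_mod_cast hn
  have hpos : (0 : ℝ) < n * (n - 1) := by nlinarith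
  rw [fluct, norm_smul, norm_inv, norm_natCast_mul_sub_one hn, inv_mul_le_iff₀ hpos]
  calc ‖∑ p ∈ pairs n, (twoBody (W - pairEnergy W v • 1) p.1 p.2 : Op d n)‖
      ≤ ∑ p ∈ pairs n, fluctBound W := norm_sum_le_of_le _ fun p hp =>
        (norm_twoBody_le _ (Finset.mem_filter.mp hp).2.ne).trans
          (entrySum_sub_smul_one_le W (norm_pairEnergy_le W hv))
    _ = (pairs n).card * fluctBound W := by simp
    _ ≤ n * (n - 1) * fluctBound W := by
        have := two_mul_card_pairs n
        gcongr
        · exact fluctBound_nonneg W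
        · linarith [(Nat.cast_nonneg (pairs n).card : (0 : ℝ) ≤ (pairs n).card)]

/-- The law of large numbers for the mean-field Hamiltonian in a product state. -/
lemma norm_fluct_mulVec_le (W : PairOp d) (hn : 2 ≤ n) {v : Fin (d + 1) → ℂ}
    (hv : ∑ j, ‖v j‖ ^ 2 = 1) :
    ‖WithLp.toLp 2 ((fluct W n v).mulVec (productVec v n))‖
      ≤ 4 * fluctBound W / Real.sqrt n := by
  have hn' : (2 : ℝ) ≤ n := by exact_mod_cast hn
  have hpos : (0 : ℝ) < n * (n - 1) := by nlinarith
  let W' : PairOp d := W - pairEnergy W v • 1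
  let u : Fin n × Fin n → EuclideanSpace ℂ (Cfg d n) := fun p =>
    WithLp.toLp 2 ((twoBody W' p.1 p.2 : Op d n).mulVec (productVec v n))
  have hu : ∀ p ∈ pairs n, ‖u p‖ ≤ fluctBound W := by
    intro p hp
    refine (l2_opNorm_mulVec_toLp _ _).trans ?_
    rw [norm_productVec hv, mul_one]
    exact (norm_twoBody_le _ (Finset.mem_filter.mp hp).2.ne).trans
      (entrySum_sub_smul_one_le W (norm_pairEnergy_le W hv))
  have hW' : ∑ p : Fin (d + 1) × Fin (d + 1),
      (starRingEnd ℂ) (v p.1 * v p.2) * pairVec W' v p = 0 := by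
    rw [sum_conj_mul_pairVec, pairEnergy_sub_smul_one W hv, sub_self]
  have h := norm_sq_sum_pairs_le u hu fun p hp q hq h1 h2 h3 h4 => by
    rw [← sum_conj_twoBody_mul_twoBody_eq_zero W' v hW' (Finset.mem_filter.mp hp).2.ne
      (Finset.mem_filter.mp hq).2.ne h1 h2 h3 h4]
    simp only [u, PiLp.inner_apply, RCLike.inner_apply]
    exact Finset.sum_congr rfl fun x _ => mul_comm _ _
  have he : WithLp.toLp 2 ((fluct W n v).mulVec (productVec v n))
      = ((n : ℂ) * (n - 1))⁻¹ • ∑ p ∈ pairs n, u p := by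
    rw [fluct, Matrix.smul_mulVec, Matrix.sum_mulVec, WithLp.toLp_smul, WithLp.toLp_sum]
  have hC := fluctBound_nonneg W
  rw [he, norm_smul, norm_inv, norm_natCast_mul_sub_one hn, inv_mul_le_iff₀ hpos]
  refine le_of_sq_le_sq (h.trans ?_) (by positivity)
  rw [mul_pow, div_pow, Real.sq_sqrt (by positivity)]
  have hn0 : (n : ℝ) ≠ 0 := by positivity
  have e : ((n : ℝ) * (n - 1)) ^ 2 * ((4 * fluctBound W) ^ 2 / n)
      = 16 * n * (n - 1) ^ 2 * fluctBound W ^ 2 := by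
    field_simp
    ring
  -- `n ≤ 2 (n - 1)` since `n ≥ 2`
  have e2 : 4 * (n : ℝ) ^ 3 ≤ 16 * n * (n - 1) ^ 2 := by
    have h5 : (n : ℝ) ^ 2 ≤ (2 * (n - 1)) ^ 2 := by gcongr; linarith
    nlinarith [mul_le_mul_of_nonneg_left h5 (by positivity : (0 : ℝ) ≤ 4 * n)]
  rw [e]
  exact mul_le_mul_of_nonneg_right e2 (by positivity)

/-! ### Exponentials near an approximate eigenvector -/

lemma norm_pow_mulVec_le {ι : Type*} [Fintype ι] [DecidableEq ι] (B : Matrix ι ι ℂ) (k : ℕ)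
    (f : ι → ℂ) : ‖WithLp.toLp 2 ((B ^ k).mulVec f)‖ ≤ ‖B‖ ^ k * ‖WithLp.toLp 2 f‖ := by
  induction k generalizing f with
  | zero => simp
  | succ k ih =>
    rw [pow_succ, ← Matrix.mulVec_mulVec, pow_succ, mul_assoc]
    exact (ih _).trans (by gcongr; exact l2_opNorm_mulVec_toLp B f)

/-- If `B f` is small, then `e^B f` is close to `f`. -/
lemma norm_exp_mulVec_sub_le {ι : Type*} [Fintype ι] [DecidableEq ι] (B : Matrix ι ι ℂ)
    (f : ι → ℂ) : ‖WithLp.toLp 2 ((NormedSpace.exp B).mulVec f - f)‖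
      ≤ Real.exp ‖B‖ * ‖WithLp.toLp 2 (B.mulVec f)‖ := by
  let L : Matrix ι ι ℂ →ₗ[ℂ] EuclideanSpace ℂ ι :=
    { toFun := fun M => WithLp.toLp 2 (M.mulVec f)
      map_add' := fun M N => by rw [Matrix.add_mulVec, WithLp.toLp_add]
      map_smul' := fun c M => by rw [Matrix.smul_mulVec, WithLp.toLp_smul, RingHom.id_apply] }
  have h1 := (NormedSpace.exp_series_hasSum_exp' (𝕂 := ℂ) B).mapL
    (LinearMap.toContinuousLinearMap L)
  have h2 := (hasSum_nat_add_iff' 1).mpr h1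
  have h3 : HasSum (fun k : ℕ => ‖B‖ ^ k / k.factorial * ‖WithLp.toLp 2 (B.mulVec f)‖)
      (Real.exp ‖B‖ * ‖WithLp.toLp 2 (B.mulVec f)‖) := by
    rw [Real.exp_eq_exp_ℝ]
    exact (NormedSpace.expSeries_div_hasSum_exp ‖B‖).mul_right _
  have h4 := tsum_of_norm_bounded h3 (f := fun k => LinearMap.toContinuousLinearMap L
    ((((k + 1).factorial : ℂ)⁻¹) • B ^ (k + 1))) fun k => by
    rw [map_smul, norm_smul]
    have h5 : ‖LinearMap.toContinuousLinearMap L (B ^ (k + 1))‖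
        ≤ ‖B‖ ^ k * ‖WithLp.toLp 2 (B.mulVec f)‖ := by
      change ‖WithLp.toLp 2 ((B ^ (k + 1)).mulVec f)‖ ≤ _
      rw [pow_succ, ← Matrix.mulVec_mulVec]
      exact norm_pow_mulVec_le B k _
    have h6 : ‖(((k + 1).factorial : ℂ)⁻¹)‖ ≤ ((k.factorial : ℝ))⁻¹ := by
      rw [norm_inv, Complex.norm_natCast]
      gcongr
      lia
    calc _ ≤ ((k.factorial : ℝ))⁻¹ * (‖B‖ ^ k * ‖WithLp.toLp 2 (B.mulVec f)‖) := by gcongr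
      _ = _ := by ring
  -- the sum from `k = 1` on is `e^B f - f`
  rw [h2.tsum_eq] at h4
  refine le_trans (le_of_eq ?_) h4
  congr 1
  simp [L]

/-- In the state `v ⊗ ⋯ ⊗ v`, the Gibbs factor `e^{-β H_n / n}` acts asymptotically as
multiplication by the classical weight, uniformly in `v`. -/
lemma norm_exp_hamiltonian_mulVec_sub_le (T : Matrix (Fin (d + 1)) (Fin (d + 1)) ℂ)
    (hT : T.IsHermitian) (V : PairOp d) (hV : V.IsHermitian) (β : ℝ) (hn : 2 ≤ n)
    {v : Fin (d + 1) → ℂ} (hv : ∑ j, ‖v j‖ ^ 2 = 1) :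
    ‖WithLp.toLp 2 ((NormedSpace.exp (-((β / n : ℝ) : ℂ) • hamiltonian T V n)).mulVec
        (productVec v n) - (weight T V β v : ℂ) • productVec v n)‖
      ≤ Real.exp (|β| * fluctBound (pairHamiltonian T V)) *
        (Real.exp (|β| * fluctBound (pairHamiltonian T V)) *
          (|β| * (4 * fluctBound (pairHamiltonian T V) / Real.sqrt n))) := by
  set W := pairHamiltonian T V with hW
  set B : Op d n := (-β : ℂ) • fluct W n v with hB
  set c : ℂ := -β * (pairEnergy W v / 2) with hc
  have hH : (-((β / n : ℝ) : ℂ) • hamiltonian T V n : Op d n) = c • 1 + B := by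
    rw [hB, fluct_eq W hn, hamiltonian_eq_sum_pairs T V hn, smul_sub, smul_smul, smul_smul,
      smul_smul, ← hc, mul_inv, ← hW]
    push_cast
    rw [show (-((β : ℂ) / n) * ((n : ℂ) - 1)⁻¹) = -β * ((n : ℂ)⁻¹ * ((n : ℂ) - 1)⁻¹) by ring]
    abel
  have hexp : NormedSpace.exp (c • 1 + B : Op d n) = Complex.exp c • NormedSpace.exp B := by
    have hcomm : Commute (c • 1 : Op d n) B := (Commute.one_left B).smul_left c
    rw [Matrix.exp_add_of_commute _ _ hcomm, ← Algebra.algebraMap_eq_smul_one,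
      ← NormedSpace.algebraMap_exp_comm, Algebra.algebraMap_eq_smul_one, smul_mul_assoc, one_mul,
      Complex.exp_eq_exp_ℂ]
  have hw : (weight T V β v : ℂ) = Complex.exp c := weight_eq_exp T hT V hV β hv
  have hS : ‖pairEnergy W v / 2‖ ≤ fluctBound W := by
    have h1 := norm_pairEnergy_le W hv
    have h2 := entrySum_nonneg W
    rw [norm_div, fluctBound]
    simp only [Complex.norm_ofNat]
    have h3 : 0 ≤ entrySum W * ((d + 1) * (d + 1)) := by positivity
    linarith [norm_nonneg (pairEnergy W v)]
  have hcn : ‖Complex.exp c‖ ≤ Real.exp (|β| * fluctBound W) := by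
    rw [Complex.norm_exp]
    gcongr
    refine (Complex.re_le_norm c).trans ?_
    rw [hc, norm_mul, norm_neg, Complex.norm_real, Real.norm_eq_abs]
    gcongr
  have hBn : ‖B‖ ≤ |β| * fluctBound W := by
    rw [hB, norm_smul, norm_neg, Complex.norm_real, Real.norm_eq_abs]
    gcongr
    exact norm_fluct_le W hn hv
  have hBv : ‖WithLp.toLp 2 (B.mulVec (productVec v n))‖
      ≤ |β| * (4 * fluctBound W / Real.sqrt n) := by
    rw [hB, Matrix.smul_mulVec, WithLp.toLp_smul, norm_smul, norm_neg, Complex.norm_real,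
      Real.norm_eq_abs]
    gcongr
    exact norm_fluct_mulVec_le W hn hv
  rw [hH, hexp, hw, Matrix.smul_mulVec, ← smul_sub, WithLp.toLp_smul, norm_smul]
  gcongr
  refine (norm_exp_mulVec_sub_le B _).trans ?_
  gcongr

/-! ### Partial traces of rank-one operators -/

lemma glue_injective {m : ℕ} (x : Cfg d m) :
    Function.Injective (glue x : ({i : Fin n // m ≤ (i : ℕ)} → Fin (d + 1)) → Cfg d n) := by
  intro z z' h
  funext i
  have h1 := congrFun h i.1
  simpa [glue, not_lt.mpr i.2] using h1

lemma norm_sum_glue_mul_conj_le {m : ℕ} (x y : Cfg d m) (f g : Cfg d n → ℂ) :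
    ‖∑ z : {i : Fin n // m ≤ (i : ℕ)} → Fin (d + 1),
      f (glue x z) * (starRingEnd ℂ) (g (glue y z))‖
      ≤ ‖WithLp.toLp 2 f‖ * ‖WithLp.toLp 2 g‖ := by
  have h : ∀ (x : Cfg d m) (f : Cfg d n → ℂ),
      ∑ z : {i : Fin n // m ≤ (i : ℕ)} → Fin (d + 1), ‖f (glue x z)‖ ^ 2 ≤ ∑ y, ‖f y‖ ^ 2 := by
    intro x f
    refine (Finset.sum_map Finset.univ ⟨glue x, glue_injective x⟩
      (fun y => ‖f y‖ ^ 2)).symm.trans_le ?_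
    exact Finset.sum_le_univ_sum_of_nonneg fun _ => by positivity
  rw [EuclideanSpace.norm_eq, EuclideanSpace.norm_eq]
  refine (norm_sum_le _ _).trans ?_
  simp only [norm_mul, RCLike.norm_conj]
  refine (Real.sum_mul_le_sqrt_mul_sqrt _ _ _).trans ?_
  gcongr
  · exact h x f
  · exact h y g

lemma productVec_glue {m : ℕ} (hm : m ≤ n) (v : Fin (d + 1) → ℂ) (x : Cfg d m)
    (z : {i : Fin n // m ≤ (i : ℕ)} → Fin (d + 1)) :
    productVec v n (glue x z) = productVec v m x * ∏ i, v (z i) := by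
  rw [productVec, ← Fintype.prod_subtype_mul_prod_subtype (fun i : Fin n => m ≤ (i : ℕ)), mul_comm]
  congr 1
  · let e : Fin m ≃ {i : Fin n // ¬ m ≤ (i : ℕ)} :=
      (Fin.castLEquiv hm).trans (Equiv.subtypeEquivRight fun i => not_le.symm)
    refine (Fintype.prod_equiv e _ _ fun k => ?_).symm
    have : ((e k : Fin n) : ℕ) = k := rfl
    simp [glue, this]
  · refine Fintype.prod_congr _ _ fun i => ?_
    simp [glue, not_lt.mpr i.2]

lemma tensorPow_proj_apply {m : ℕ} (v : Fin (d + 1) → ℂ) (x y : Cfg d m) :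
    tensorPow (proj v) m x y = productVec v m x * (starRingEnd ℂ) (productVec v m y) := by
  simp [tensorPow, proj, productVec, Matrix.vecMulVec_apply, Finset.prod_mul_distrib]

lemma sum_glue_productVec {m : ℕ} (hm : m ≤ n) {v : Fin (d + 1) → ℂ}
    (hv : ∑ j, ‖v j‖ ^ 2 = 1) (x y : Cfg d m) :
    ∑ z : {i : Fin n // m ≤ (i : ℕ)} → Fin (d + 1),
      productVec v n (glue x z) * (starRingEnd ℂ) (productVec v n (glue y z))
      = tensorPow (proj v) m x y := by
  have h : ∑ z : {i : Fin n // m ≤ (i : ℕ)} → Fin (d + 1),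
      ∏ i, (v (z i) * (starRingEnd ℂ) (v (z i))) = 1 := by
    have h1 := Finset.prod_univ_sum (fun _ : {i : Fin n // m ≤ (i : ℕ)} => Finset.univ)
      (fun _ (j : Fin (d + 1)) => v j * (starRingEnd ℂ) (v j))
    rw [Fintype.piFinset_univ] at h1
    rw [← h1]
    simp [sum_conj_mul_self hv]
  rw [tensorPow_proj_apply, ← mul_one (productVec v m x * _), ← h, Finset.mul_sum]
  refine Finset.sum_congr rfl fun z _ => ?_
  rw [productVec_glue hm, productVec_glue hm, map_mul, map_prod, Finset.prod_mul_distrib]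
  ring

/-- The partial trace over all factors is the trace; `Cfg d 0` has exactly one element. -/
lemma trace_eq_reduction_zero (D : Op d n) (x : Cfg d 0) : D.trace = reduction 0 D x x := by
  refine (Fintype.sum_bijective (glue x) ⟨glue_injective x, fun y => ?_⟩ _ _ fun z => rfl).symm
  exact ⟨fun i => y i, by funext i; simp [glue]⟩

/-! ### The classical integrals -/

lemma sum_norm_sq_vec {p : Fin (d + 1) → ℝ} (hp : p ∈ stdSimplex ℝ (Fin (d + 1)))
    (θ : Fin (d + 1) → ℝ) : ∑ j, ‖vec p θ j‖ ^ 2 = 1 := by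
  rw [← hp.2]
  refine Finset.sum_congr rfl fun j _ => ?_
  rw [vec, norm_mul, mul_comm Complex.I, Complex.norm_exp_ofReal_mul_I, one_mul,
    Complex.norm_real, Real.norm_of_nonneg (Real.sqrt_nonneg _), Real.sq_sqrt (hp.1 j)]

lemma continuous_weight (T : Matrix (Fin (d + 1)) (Fin (d + 1)) ℂ) (V : PairOp d) (β : ℝ) :
    Continuous fun w : (Fin (d + 1) → ℝ) × (Fin (d + 1) → ℝ) => weight T V β (vec w.1 w.2) := by
  have hP : ∀ a b, Continuous fun w : (Fin (d + 1) → ℝ) × (Fin (d + 1) → ℝ) =>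
      proj (vec w.1 w.2) a b := fun a b => by
    simp only [proj, Matrix.vecMulVec_apply, Pi.star_apply]
    exact (continuous_vec a).mul (continuous_vec b).star
  have h1 : Continuous fun w : (Fin (d + 1) → ℝ) × (Fin (d + 1) → ℝ) =>
      (T * proj (vec w.1 w.2)).trace := by
    simp only [Matrix.trace, Matrix.diag, Matrix.mul_apply]
    fun_prop
  have h2 : Continuous fun w : (Fin (d + 1) → ℝ) × (Fin (d + 1) → ℝ) =>
      (V * (proj (vec w.1 w.2) ⊗ₖ proj (vec w.1 w.2))).trace := by
    simp only [Matrix.trace, Matrix.diag, Matrix.mul_apply, Matrix.kroneckerMap_apply]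
    fun_prop
  unfold weight
  fun_prop

lemma continuous_tensorPow_proj {m : ℕ} (x y : Cfg d m) :
    Continuous fun w : (Fin (d + 1) → ℝ) × (Fin (d + 1) → ℝ) =>
      tensorPow (proj (vec w.1 w.2)) m x y := by
  simp_rw [tensorPow_proj_apply]
  exact (continuous_productVec x).mul (Complex.continuous_conj.comp (continuous_productVec y))

lemma integrable_weight (T : Matrix (Fin (d + 1)) (Fin (d + 1)) ℂ) (V : PairOp d) (β : ℝ) :
    Integrable (fun w => weight T V β (vec w.1 w.2)) (stateMeasure d) :=
  integrable_of_continuous (continuous_weight T V β)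

lemma integrable_tensorPow_mul_weight (T : Matrix (Fin (d + 1)) (Fin (d + 1)) ℂ) (V : PairOp d)
    (β : ℝ) {m : ℕ} (x y : Cfg d m) :
    Integrable (fun w => tensorPow (proj (vec w.1 w.2)) m x y *
      (weight T V β (vec w.1 w.2) : ℂ)) (stateMeasure d) :=
  integrable_of_continuous ((continuous_tensorPow_proj x y).mul
    (Complex.continuous_ofReal.comp (continuous_weight T V β)))

lemma partitionFn_eq (T : Matrix (Fin (d + 1)) (Fin (d + 1)) ℂ) (V : PairOp d) (β : ℝ) :
    partitionFn T V β = ∫ w, weight T V β (vec w.1 w.2) ∂stateMeasure d :=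
  (integral_prod _ (integrable_weight T V β)).symm

lemma deFinettiIntegral_apply (T : Matrix (Fin (d + 1)) (Fin (d + 1)) ℂ) (V : PairOp d) (β : ℝ)
    {m : ℕ} (x y : Cfg d m) : deFinettiIntegral T V β m x y
      = ∫ w, tensorPow (proj (vec w.1 w.2)) m x y * (weight T V β (vec w.1 w.2) : ℂ)
        ∂stateMeasure d :=
  (integral_prod _ (integrable_tensorPow_mul_weight T V β x y)).symm

lemma partitionFn_pos (T : Matrix (Fin (d + 1)) (Fin (d + 1)) ℂ) (V : PairOp d) (β : ℝ) :
    0 < partitionFn T V β := by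
  rw [partitionFn_eq]
  exact integral_exp_pos (integrable_weight T V β)

lemma deFinettiIntegral_zero_apply (T : Matrix (Fin (d + 1)) (Fin (d + 1)) ℂ) (V : PairOp d)
    (β : ℝ) (x : Cfg d 0) : deFinettiIntegral T V β 0 x x = partitionFn T V β := by
  rw [deFinettiIntegral_apply, partitionFn_eq, ← integral_complex_ofReal]
  simp [tensorPow]

lemma trace_deFinettiIntegral (T : Matrix (Fin (d + 1)) (Fin (d + 1)) ℂ) (V : PairOp d) (β : ℝ)
    (m : ℕ) : (deFinettiIntegral T V β m).trace = partitionFn T V β := by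
  simp only [Matrix.trace, Matrix.diag, deFinettiIntegral_apply]
  rw [← integral_finsetSum _ fun x _ => integrable_tensorPow_mul_weight T V β x x,
    partitionFn_eq, ← integral_complex_ofReal]
  refine integral_congr_ae ?_
  filter_upwards [ae_fst_mem_stdSimplex d] with w hw
  have h : ∑ x, tensorPow (proj (vec w.1 w.2)) m x x = 1 := by
    simp only [tensorPow, Matrix.of_apply]
    rw [← Fintype.sum_pow (fun j => proj (vec w.1 w.2) j j)]
    have := trace_proj (sum_norm_sq_vec hw w.2)
    rw [Matrix.trace] at this
    simp only [Matrix.diag] at this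
    rw [this, one_pow]
  rw [← Finset.sum_mul, h, one_mul]

lemma posSemidef_deFinettiIntegral (T : Matrix (Fin (d + 1)) (Fin (d + 1)) ℂ) (V : PairOp d)
    (β : ℝ) (m : ℕ) : (deFinettiIntegral T V β m).PosSemidef := by
  refine Matrix.PosSemidef.of_dotProduct_mulVec_nonneg ?_ fun f => ?_
  · ext x y
    rw [Matrix.conjTranspose_apply, deFinettiIntegral_apply, deFinettiIntegral_apply,
      ← starRingEnd_apply, ← integral_conj]
    refine integral_congr_ae (Eventually.of_forall fun w => ?_)
    simp [tensorPow_proj_apply, mul_comm]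
  · have h : star f ⬝ᵥ (deFinettiIntegral T V β m).mulVec f
        = ∫ w, ((Complex.normSq (∑ x, star (f x) * productVec (vec w.1 w.2) m x) *
          weight T V β (vec w.1 w.2) : ℝ) : ℂ) ∂stateMeasure d := by
      simp only [dotProduct, Matrix.mulVec, deFinettiIntegral_apply, Pi.star_apply]
      simp_rw [← integral_mul_const, ← integral_finsetSum _ fun y _ =>
        (integrable_tensorPow_mul_weight T V β _ y).mul_const (f y), ← integral_const_mul]
      rw [← integral_finsetSum]
      · refine integral_congr_ae (Eventually.of_forall fun w => ?_)
        simp only [Complex.ofReal_mul, ← Complex.mul_conj, map_sum, Finset.sum_mul,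
          Finset.mul_sum, tensorPow_proj_apply]
        rw [Finset.sum_comm]
        refine Finset.sum_congr rfl fun x _ => Finset.sum_congr rfl fun y _ => ?_
        simp
        ring
      · intro x _
        exact (integrable_finsetSum _ fun y _ =>
          (integrable_tensorPow_mul_weight T V β x y).mul_const (f y)).const_mul _
    rw [h, integral_complex_ofReal]
    refine Complex.zero_le_real.mpr (integral_nonneg fun w => ?_)
    exact mul_nonneg (Complex.normSq_nonneg _) (Real.exp_pos _).le

/-! ### The mean-field limit -/

/-- The dimension of the symmetric subspace of `(ℂ^{d+1})^{⊗ n}`. -/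
def symDim (d n : ℕ) : ℂ := (n + d).factorial / (n.factorial * d.factorial)

lemma symDim_ne_zero (d n : ℕ) : symDim d n ≠ 0 := by
  have h1 : ((n + d).factorial : ℂ) ≠ 0 := by exact_mod_cast (n + d).factorial_ne_zero
  have h2 : (d.factorial : ℂ) ≠ 0 := by exact_mod_cast d.factorial_ne_zero
  have h3 : (n.factorial : ℂ) ≠ 0 := by exact_mod_cast n.factorial_ne_zero
  exact div_ne_zero h1 (mul_ne_zero h3 h2)

lemma integrable_mulVec_mul_conj (E : Op d n) (x y : Cfg d n) :
    Integrable (fun w => E.mulVec (productVec (vec w.1 w.2) n) x *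
      (starRingEnd ℂ) (productVec (vec w.1 w.2) n y)) (stateMeasure d) := by
  refine integrable_of_continuous (Continuous.mul ?_
    (Complex.continuous_conj.comp (continuous_productVec y)))
  exact continuous_finsetSum _ fun z _ => continuous_const.mul (continuous_productVec z)

lemma mul_symProj_apply (E : Op d n) (x y : Cfg d n) :
    (E * symProj d n) x y = symDim d n *
      ∫ w, E.mulVec (productVec (vec w.1 w.2) n) x *
        (starRingEnd ℂ) (productVec (vec w.1 w.2) n y) ∂stateMeasure d := by
  simp only [Matrix.mul_apply, symProj_apply, Matrix.mulVec, dotProduct, Finset.sum_mul]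
  rw [integral_finsetSum, Finset.mul_sum]
  · refine Finset.sum_congr rfl fun z _ => ?_
    simp_rw [mul_assoc (E x z), integral_const_mul]
    rw [symDim]
    ring
  · intro z _
    refine integrable_of_continuous ((continuous_const.mul (continuous_productVec z)).mul
      (Complex.continuous_conj.comp (continuous_productVec y)))

lemma reduction_mul_symProj_apply {m : ℕ} (E : Op d n) (x y : Cfg d m) :
    reduction m (E * symProj d n) x y = symDim d n *
      ∫ w, ∑ z : {i : Fin n // m ≤ (i : ℕ)} → Fin (d + 1),
        E.mulVec (productVec (vec w.1 w.2) n) (glue x z) *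
          (starRingEnd ℂ) (productVec (vec w.1 w.2) n (glue y z)) ∂stateMeasure d := by
  rw [integral_finsetSum _ fun z _ => integrable_mulVec_mul_conj E _ _, Finset.mul_sum]
  simp [reduction, mul_symProj_apply]

/-- The unnormalized reductions, divided by the dimension of the symmetric subspace, converge. -/
lemma tendsto_reduction_gibbsNumerator (T : Matrix (Fin (d + 1)) (Fin (d + 1)) ℂ)
    (hT : T.IsHermitian) (V : PairOp d) (hV : V.IsHermitian) (β : ℝ) {m : ℕ} (x y : Cfg d m) :
    Tendsto (fun n : ℕ => (symDim d n)⁻¹ * reduction m (gibbsNumerator T V n (β / n)) x y) atTop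
      (𝓝 (deFinettiIntegral T V β m x y)) := by
  rw [tendsto_iff_norm_sub_tendsto_zero]
  set C := fluctBound (pairHamiltonian T V)
  have hlim : Tendsto (fun n : ℕ => Real.exp (|β| * C) *
      (Real.exp (|β| * C) * (|β| * (4 * C / Real.sqrt n)))) atTop (𝓝 0) := by
    have h : Tendsto (fun n : ℕ => 4 * C / Real.sqrt n) atTop (𝓝 0) :=
      Tendsto.const_div_atTop (Real.tendsto_sqrt_atTop.comp tendsto_natCast_atTop_atTop) _
    simpa using ((h.const_mul |β|).const_mul (Real.exp (|β| * C))).const_mul (Real.exp (|β| * C))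
  refine squeeze_zero' (Eventually.of_forall fun _ => norm_nonneg _) ?_ hlim
  filter_upwards [eventually_ge_atTop 2, eventually_ge_atTop m] with n hn hm
  set E : Op d n := NormedSpace.exp (-((β / n : ℝ) : ℂ) • hamiltonian T V n) with hE
  have hN : gibbsNumerator T V n (β / n) = E * symProj d n := rfl
  rw [hN, reduction_mul_symProj_apply, inv_mul_cancel_left₀ (symDim_ne_zero d n),
    deFinettiIntegral_apply, ← integral_sub
      (integrable_finsetSum _ fun z _ => integrable_mulVec_mul_conj E _ _)
      (integrable_tensorPow_mul_weight T V β x y)]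
  refine (norm_integral_le_of_norm_le_const (C := Real.exp (|β| * C) *
    (Real.exp (|β| * C) * (|β| * (4 * C / Real.sqrt n)))) ?_).trans_eq (by simp)
  filter_upwards [ae_fst_mem_stdSimplex d] with w hw
  have hv := sum_norm_sq_vec hw w.2
  set v := vec w.1 w.2
  rw [← sum_glue_productVec hm hv, Finset.sum_mul, ← Finset.sum_sub_distrib]
  have h1 : ∀ z : {i : Fin n // m ≤ (i : ℕ)} → Fin (d + 1),
      E.mulVec (productVec v n) (glue x z) * (starRingEnd ℂ) (productVec v n (glue y z)) -
        productVec v n (glue x z) * (starRingEnd ℂ) (productVec v n (glue y z)) *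
          (weight T V β v : ℂ)
      = (E.mulVec (productVec v n) - (weight T V β v : ℂ) • productVec v n) (glue x z) *
        (starRingEnd ℂ) (productVec v n (glue y z)) := by
    intro z
    simp only [Pi.sub_apply, Pi.smul_apply, smul_eq_mul]
    ring
  simp_rw [h1]
  refine (norm_sum_glue_mul_conj_le x y _ _).trans ?_
  rw [norm_productVec hv, mul_one]
  exact norm_exp_hamiltonian_mulVec_sub_le T hT V hV β hn hv

lemma tendsto_reduction_gibbs (T : Matrix (Fin (d + 1)) (Fin (d + 1)) ℂ)
    (hT : T.IsHermitian) (V : PairOp d) (hV : V.IsHermitian) (β : ℝ) (m : ℕ) :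
    Tendsto (fun n : ℕ => reduction m (gibbs T V n (β / n))) atTop
      (𝓝 ((partitionFn T V β : ℂ)⁻¹ • deFinettiIntegral T V β m)) := by
  refine tendsto_pi_nhds.mpr fun x => tendsto_pi_nhds.mpr fun y => ?_
  -- the partial trace over all factors is the trace, so `m = 0` is the partition function
  have htr := tendsto_reduction_gibbsNumerator T hT V hV β (fun i : Fin 0 => i.elim0)
    (fun i : Fin 0 => i.elim0)
  rw [deFinettiIntegral_zero_apply] at htr
  have hZ : (partitionFn T V β : ℂ) ≠ 0 := by exact_mod_cast (partitionFn_pos T V β).ne'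
  refine ((htr.inv₀ hZ).mul (tendsto_reduction_gibbsNumerator T hT V hV β x y)).congr fun n => ?_
  rw [← trace_eq_reduction_zero, mul_inv, inv_inv, mul_mul_mul_comm,
    mul_inv_cancel₀ (symDim_ne_zero d n), one_mul]
  simp [reduction, gibbs, Finset.mul_sum]

end MeanFieldBosons

end

theorem proposition4 (d : ℕ)
    (T : Matrix (Fin (d + 1)) (Fin (d + 1)) ℂ) (hT : T.IsHermitian)
    (V : Matrix (Fin (d + 1) × Fin (d + 1)) (Fin (d + 1) × Fin (d + 1)) ℂ)
    (hV : V.IsHermitian)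
    (hVsymm : V.submatrix Prod.swap Prod.swap = V)
    (β : ℝ) :
    Integrable (fun w : (Fin (d + 1) → ℝ) × (Fin (d + 1) → ℝ) =>
        MeanFieldBosons.weight T V β (MeanFieldBosons.vec w.1 w.2))
      ((MeanFieldBosons.simplexMeasure d).prod (MeanFieldBosons.phaseMeasure d)) ∧
    0 < MeanFieldBosons.partitionFn T V β ∧
    ∀ m : ℕ,
      (∀ x y : MeanFieldBosons.Cfg d m,
        Integrable (fun w : (Fin (d + 1) → ℝ) × (Fin (d + 1) → ℝ) =>
            MeanFieldBosons.tensorPow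
                (MeanFieldBosons.proj (MeanFieldBosons.vec w.1 w.2)) m x y
              * (MeanFieldBosons.weight T V β (MeanFieldBosons.vec w.1 w.2) : ℂ))
          ((MeanFieldBosons.simplexMeasure d).prod (MeanFieldBosons.phaseMeasure d))) ∧
      ∃ G : MeanFieldBosons.Op d m,
        Tendsto (fun n : ℕ =>
            MeanFieldBosons.reduction m (MeanFieldBosons.gibbs T V n (β / n)))
          atTop (𝓝 G) ∧
        G.PosSemidef ∧ G.trace = 1 ∧
        G = (MeanFieldBosons.partitionFn T V β : ℂ)⁻¹ •
          MeanFieldBosons.deFinettiIntegral T V β m := by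
  have hZ := MeanFieldBosons.partitionFn_pos T V β
  have hZ' : (MeanFieldBosons.partitionFn T V β : ℂ) ≠ 0 := by exact_mod_cast hZ.ne'
  refine ⟨MeanFieldBosons.integrable_weight T V β, hZ, fun m =>
    ⟨MeanFieldBosons.integrable_tensorPow_mul_weight T V β, _,
      MeanFieldBosons.tendsto_reduction_gibbs T hT V hV β m, ?_, ?_, rfl⟩⟩
  · refine (MeanFieldBosons.posSemidef_deFinettiIntegral T V β m).smul ?_
    rw [← Complex.ofReal_inv]
    exact Complex.zero_le_real.mpr (inv_nonneg.mpr hZ.le)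
  · rw [Matrix.trace_smul, MeanFieldBosons.trace_deFinettiIntegral, smul_eq_mul,
      inv_mul_cancel₀ hZ']
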